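/- Setting. Let $d\ge 1$, let $\mathcal X\subset\mathbb R^d$ be a closed convex set contained in the Euclidean ball of radius $R$ about the origin, let $x_0\in\mathcal X$, let $T\in\mathbb N$ and $\eta,\delta,D>0$. Directions $u_0,\dots,u_T$ are drawn successively; given the past $\mathcal F_t$ (a filtration for which $u_s$ is $\mathcal F_t$-measurable whenever $s<t$), $u_t$ is uniformly distributed on the unit sphere of $\mathbb R^d$ and independent of $\mathcal F_t$. The loss functions $f_0,\dots,f_T$ are fixed in advance or, more generally, $f_t$ is determined by $\mathcal F_t$. Each $f_t$ is convex on $\mathcal X$ and $L_t$-Lipschitz (with deterministic $L_t$) on the closed $\delta$-neighbourhood of $\mathcal X$, which contains all query points; put $L=\max_{0\le t\le T}L_t$. Write $w_t=x_t+\delta u_t$ and $$\tilde g^{(1)}_t=\frac{d\,u_t}{\delta}\bigl(f_t(w_t)-f_{t-1}(w_{t-1})\bigr),\qquad \tilde g^{(2)}_t=\frac{d\,u_t}{2\delta}\bigl(f_t(x_t+\delta u_t)-f_t(x_t-\delta u_t)\bigr),$$ $$D^a_t=\frac{|f_t(w_t)-f_{t-1}(w_{t-1})|}{\|w_t-w_{t-1}\|},\qquad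 D^b_t=\frac{|f_t(w_t)-f_{t-1}(w_{t-1})|}{\eta L}$$ (with $r/0=\infty$ for $r>0$ and $0/0=0$). For $\ast\in\{a,b\}$ the lazy method $\ast$ starts from $x_0$ with $\tilde g^\ast_0=\tilde g^{(2)}_0$, moves by $x_{t+1}=\Pi_{\mathcal X}(x_t-\eta\tilde g^\ast_t)$, where $\Pi_{\mathcal X}$ is the Euclidean projection, and for $t\ge1$ uses $\tilde g^\ast_t=\tilde g^{(1)}_t$ if $D^\ast_t\le D$ and $\tilde g^\ast_t=\tilde g^{(2)}_t$ otherwise; let $x^\ast_t$ denote its iterates. Claim. There is an absolute constant $c>0$ such that in every such setting $x^\ast_t$ is $\mathcal F_t$-measurable, $\|\tilde g^\ast_t\|^2$ is integrable for $0\le t\le T$, and almost surely $$\mathbb E\bigl[\|\tilde g^a_t\|^2\,\big|\,\mathcal F_t\bigr]\le c\,dL^2+\frac{2d^2D^2\eta^2}{\delta^2}\|\tilde g^a_{t-1}\|^2+8d^2D^2\qquad(1\le t\le T),$$ $$\mathbb E\bigl[\|\tilde g^b_t\|^2\,\big|\,\mathcal F_t\bigr]\le \frac{D^2\eta^2d^2L^2}{\delta^2}+c\,dL^2\qquad(0\le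 t\le T).$$ The same bounds hold when one conditions on the iterate $x^a_t$, respectively $x^b_t$, alone, with $\|\tilde g^a_{t-1}\|^2$ replaced by $\mathbb E[\|\tilde g^a_{t-1}\|^2\,|\,x^a_t]$ in the first one. Moreover, if $\eta=\frac{R}{L\sqrt{dT}}$ and $\delta=R\sqrt{d/T}$, then both conditional second moments given $\mathcal F_t$ are $O(d)$: for every $K$ and all $0\le t\le T$, if $D\le K L/\sqrt d$ and $D<L/\sqrt{10}$ then $\mathbb E[\|\tilde g^a_t\|^2|\mathcal F_t]\le (c+10K^2)\,dL^2$ almost surely, and if $D\le K\sqrt d\,L$ then $\mathbb E[\|\tilde g^b_t\|^2|\mathcal F_t]\le (c+K^2)\,dL^2$ almost surely. -/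

import Mathlib

open MeasureTheory ProbabilityTheory
open scoped NNReal ENNReal

/-- The uniform probability distribution `U(𝕊)` on the Euclidean unit sphere of `ℝ^d`:
the normalized surface measure. -/
noncomputable def uniformSphere (d : ℕ) :
    Measure (Metric.sphere (0 : EuclideanSpace ℝ (Fin d)) 1) :=
  ((volume : Measure (EuclideanSpace ℝ (Fin d))).toSphere Set.univ)⁻¹ •
    (volume : Measure (EuclideanSpace ℝ (Fin d))).toSphere

/-- Euclidean projection onto `X`: a point of `X` at minimal distance from `y`. It exists if `X` is
closed and non-empty, and is unique if `X` is moreover convex. -/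
noncomputable def euclideanProj {d : ℕ} (X : Set (EuclideanSpace ℝ (Fin d)))
    (y : EuclideanSpace ℝ (Fin d)) : EuclideanSpace ℝ (Fin d) :=
  Classical.epsilon fun p => p ∈ X ∧ ∀ z ∈ X, ‖y - p‖ ≤ ‖y - z‖

/-- One-point residual estimator `(d u / δ) (f(x + δ u) - f'(x' + δ u'))`, where `f'`, `x'`, `u'`
belong to the previous round. -/
noncomputable def residualEstimator {d : ℕ} (δ : ℝ) (f f' : EuclideanSpace ℝ (Fin d) → ℝ)
    (x u x' u' : EuclideanSpace ℝ (Fin d)) : EuclideanSpace ℝ (Fin d) :=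
  ((d : ℝ) / δ * (f (x + δ • u) - f' (x' + δ • u'))) • u

/-- Symmetric two-point estimator `(d u / (2 δ)) (f(x + δ u) - f(x - δ u))`. -/
noncomputable def twoPointEstimator {d : ℕ} (δ : ℝ) (f : EuclideanSpace ℝ (Fin d) → ℝ)
    (x u : EuclideanSpace ℝ (Fin d)) : EuclideanSpace ℝ (Fin d) :=
  ((d : ℝ) / (2 * δ) * (f (x + δ • u) - f (x - δ • u))) • u

/-- Temporal variation `D^a(x, y) = |f x - f' y| / ‖x - y‖`, with values in `[0, ∞]`, so that
`r / 0 = ∞` for `r > 0` and `0 / 0 = 0`. -/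
noncomputable def temporalVariationA {d : ℕ} (f f' : EuclideanSpace ℝ (Fin d) → ℝ)
    (x y : EuclideanSpace ℝ (Fin d)) : ℝ≥0∞ :=
  ENNReal.ofReal |f x - f' y| / ENNReal.ofReal ‖x - y‖

/-- Temporal variation `D^b(x, y) = |f x - f' y| / (η L)`, with values in `[0, ∞]`. -/
noncomputable def temporalVariationB {d : ℕ} (η L : ℝ) (f f' : EuclideanSpace ℝ (Fin d) → ℝ)
    (x y : EuclideanSpace ℝ (Fin d)) : ℝ≥0∞ :=
  ENNReal.ofReal |f x - f' y| / ENNReal.ofReal (η * L)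

open Classical in
/-- Lazy estimator with temporal variation `V` and threshold `D`: the one-point residual estimator
if `V (x + δ u, x' + δ u') ≤ D`, and the symmetric two-point estimator otherwise. -/
noncomputable def lazyEstimator {d : ℕ}
    (V : (EuclideanSpace ℝ (Fin d) → ℝ) → (EuclideanSpace ℝ (Fin d) → ℝ) →
      EuclideanSpace ℝ (Fin d) → EuclideanSpace ℝ (Fin d) → ℝ≥0∞)
    (δ D : ℝ) (f f' : EuclideanSpace ℝ (Fin d) → ℝ)
    (x u x' u' : EuclideanSpace ℝ (Fin d)) : EuclideanSpace ℝ (Fin d) :=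
  if V f f' (x + δ • u) (x' + δ • u') ≤ ENNReal.ofReal D then
    residualEstimator δ f f' x u x' u'
  else twoPointEstimator δ f x u

/-- The lazy zeroth-order method with temporal variation `V`, run on the losses `f 0, f 1, …` and
the directions `u 0, u 1, …`. The value at `t` is the pair of the iterate `x_t` and the gradient
estimate `g_t`; the first estimate is the two-point one, and `x_{t+1} = Π_X (x_t - η g_t)`. -/
noncomputable def lazoRun {d : ℕ}
    (V : (EuclideanSpace ℝ (Fin d) → ℝ) → (EuclideanSpace ℝ (Fin d) → ℝ) →
      EuclideanSpace ℝ (Fin d) → EuclideanSpace ℝ (Fin d) → ℝ≥0∞)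
    (X : Set (EuclideanSpace ℝ (Fin d))) (x₀ : EuclideanSpace ℝ (Fin d)) (η δ D : ℝ)
    (f : ℕ → EuclideanSpace ℝ (Fin d) → ℝ) (u : ℕ → EuclideanSpace ℝ (Fin d)) :
    ℕ → EuclideanSpace ℝ (Fin d) × EuclideanSpace ℝ (Fin d)
  | 0 => (x₀, twoPointEstimator δ (f 0) x₀ (u 0))
  | t + 1 =>
    let p := lazoRun V X x₀ η δ D f u t
    let x := euclideanProj X (p.1 - η • p.2)
    (x, lazyEstimator V δ D (f (t + 1)) (f t) x (u (t + 1)) p.1 (u t))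

/-! ### Gaussian measure: radial density, moments, and a dimension-free Poincaré inequality. -/

section Gaussian

variable {E : Type*} [NormedAddCommGroup E] [InnerProductSpace ℝ E] [FiniteDimensional ℝ E]
  [MeasurableSpace E] [BorelSpace E]

/-! Every estimate of a lazy method is either the two-point estimator or a residual that passed the
threshold test, and the test bounds the latter deterministically. Hence `‖g_t‖² ≤ A + ‖two-point‖²`
pointwise, where `A` is known before `u_t` is drawn. For variation `b`, `A` is a constant. For
variation `a`, the query points are at most `‖x_t - x_{t-1}‖ + 2δ` apart, and nonexpansiveness of
the projection gives `‖x_t - x_{t-1}‖ ≤ η ‖g_{t-1}‖`, so `A` is affine in `‖g_{t-1}‖²`. Taking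
conditional expectations (`condExp_ae_le_add_of_le_add`) leaves only the two-point estimator.

The crude bound on its square is `d² L²`; order `d L²` is concentration of measure. For a frozen
past, `v ↦ f(x + δv) - f(x - δv)` is odd and `2δL`-Lipschitz on the sphere, and
`integral_sq_uniformSphere_le_of_odd` bounds the second moment of an odd `K`-Lipschitz function
there by `12 K² / d`. That bound comes from Gaussian space. The 1-homogeneous extension is odd and
`3K`-Lipschitz, its Gaussian second moment is `d` times the spherical one by polar coordinates, and
it is at most `π²/8 · (3K)²` by a Poincaré inequality. The latter is proved by rotating one Gaussian
vector into an independent copy (`integral_sub_sq_le_of_rotation`,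
`integral_sub_sq_stdGaussian_le`).

For the tuned parameters `η d L / δ = 1`. Method `b` is then immediate; for method `a`, the
condition `10 D² ≤ L²` makes the pathwise bound `‖g_t‖ ≤ d L` self-reproducing, and it is inserted
into the recursion. -/

theorem integrable_exp_neg_half_mul_sq_norm :
    Integrable (fun x : E => Real.exp (-(1 / 2 : ℝ) * ‖x‖ ^ 2)) := by
  have h := GaussianFourier.integrable_cexp_neg_mul_sq_norm_add (V := E) (b := (1 / 2 : ℂ))
    (by norm_num) 0 0
  refine h.norm.congr (.of_forall fun x => ?_)
  simp only [Complex.norm_exp]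
  congr 1
  have : (-(1 / 2 : ℂ) * (‖x‖ : ℂ) ^ 2 + 0 * ((inner ℝ (0 : E) x : ℝ) : ℂ))
      = ((-(1 / 2 : ℝ) * ‖x‖ ^ 2 : ℝ) : ℂ) := by
    push_cast; ring
  rw [this, Complex.ofReal_re]

theorem integral_exp_neg_half_mul_sq_norm_pos :
    0 < ∫ x : E, Real.exp (-(1 / 2 : ℝ) * ‖x‖ ^ 2) := by
  rw [GaussianFourier.integral_rexp_neg_mul_sq_norm (by norm_num)]
  positivity

/-- The standard Gaussian measure has a radial density with respect to the volume. -/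
theorem stdGaussian_eq_withDensity :
    stdGaussian E = (volume : Measure E).withDensity fun x =>
      ENNReal.ofReal ((∫ y : E, Real.exp (-(1 / 2 : ℝ) * ‖y‖ ^ 2))⁻¹ *
        Real.exp (-(1 / 2 : ℝ) * ‖x‖ ^ 2)) := by
  set Z : ℝ := ∫ y : E, Real.exp (-(1 / 2 : ℝ) * ‖y‖ ^ 2) with hZ
  have hZpos : 0 < Z := integral_exp_neg_half_mul_sq_norm_pos
  have hint : Integrable fun x : E => Z⁻¹ * Real.exp (-(1 / 2 : ℝ) * ‖x‖ ^ 2) :=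
    integrable_exp_neg_half_mul_sq_norm.const_mul _
  have hfin : IsFiniteMeasure ((volume : Measure E).withDensity fun x =>
      ENNReal.ofReal (Z⁻¹ * Real.exp (-(1 / 2 : ℝ) * ‖x‖ ^ 2))) :=
    isFiniteMeasure_withDensity_ofReal hint.2
  -- Finite measures are determined by their characteristic functions, and the Gaussian Fourier
  -- integral computes that of the density.
  refine Measure.ext_of_charFun (funext fun t => ?_)
  rw [charFun_stdGaussian, charFun_apply,
    integral_withDensity_eq_integral_toReal_smul (by fun_prop) (by simp)]
  have hZC : (Z : ℂ) = (Real.pi / (1 / 2 : ℂ)) ^ (Module.finrank ℝ E / 2 : ℂ) := by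
    have h := GaussianFourier.integral_cexp_neg_mul_sq_norm (V := E) (b := (1 / 2 : ℂ))
      (by norm_num)
    rw [← h, hZ, ← integral_complex_ofReal]
    refine integral_congr_ae (.of_forall fun x => ?_)
    push_cast
    rfl
  have hmain := GaussianFourier.integral_cexp_neg_mul_sq_norm_add (V := E) (b := (1 / 2 : ℂ))
      (by norm_num) Complex.I t
  have hZ0 : (Z : ℂ) ≠ 0 := by exact_mod_cast hZpos.ne'
  have : ∀ x : E, (ENNReal.ofReal (Z⁻¹ * Real.exp (-(1 / 2 : ℝ) * ‖x‖ ^ 2))).toReal •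
      Complex.exp (inner ℝ x t * Complex.I) =
      (Z : ℂ)⁻¹ * Complex.exp (-(1 / 2 : ℂ) * ‖x‖ ^ 2 + Complex.I * inner ℝ t x) := by
    intro x
    rw [ENNReal.toReal_ofReal (by positivity), Complex.exp_add, real_inner_comm,
      Complex.real_smul]
    push_cast
    ring_nf
  simp_rw [this]
  rw [integral_const_mul, hmain, ← hZC, inv_mul_cancel_left₀ hZ0]
  congr 1
  simp
  ring

/-- Carries Rademacher's theorem from Lebesgue measure to Gaussian measure. -/
theorem stdGaussian_absolutelyContinuous : stdGaussian E ≪ (volume : Measure E) := by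
  rw [stdGaussian_eq_withDensity]
  exact withDensity_absolutelyContinuous _ _

theorem integral_sq_strongDual_stdGaussian (l : StrongDual ℝ E) :
    ∫ x, l x ^ 2 ∂(stdGaussian E) = ‖l‖ ^ 2 := by
  rw [← variance_dual_stdGaussian, variance_of_integral_eq_zero]
  · exact l.continuous.aemeasurable
  · exact integral_strongDual_stdGaussian l

theorem integrable_sq_norm_stdGaussian : Integrable (fun x : E => ‖x‖ ^ 2) (stdGaussian E) := by
  have := (IsGaussian.memLp_two_id (μ := stdGaussian E)).integrable_norm_pow (by norm_num)
  simpa using this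

theorem integral_sq_norm_stdGaussian :
    ∫ x, ‖x‖ ^ 2 ∂(stdGaussian E) = Module.finrank ℝ E := by
  have h : ∀ x : E, ‖x‖ ^ 2 = ∑ i, (innerSL ℝ (stdOrthonormalBasis ℝ E i) x) ^ 2 := by
    intro x
    simpa using ((stdOrthonormalBasis ℝ E).sum_sq_inner_right x).symm
  simp_rw [h]
  rw [integral_finsetSum]
  · simp only [integral_sq_strongDual_stdGaussian]
    simp
  · intro i _
    refine (IsGaussian.memLp_dual (stdGaussian E)
      (innerSL ℝ (stdOrthonormalBasis ℝ E i)) 2 (by simp)).integrable_sq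

/-- Increments of a Lipschitz function along `N` successive rotations of a pair of independent
Gaussian vectors are identically distributed. -/
theorem integral_sub_sq_le_of_rotation {F : E → ℝ} {K : ℝ≥0} (hF : LipschitzWith K F) (N : ℕ)
    (hN : N ≠ 0) :
    ∫ p, (F p.2 - F p.1) ^ 2 ∂((stdGaussian E).prod (stdGaussian E)) ≤
      ∫ p, ((N : ℝ) * (F (Real.cos (Real.pi / 2 / N) • p.1 + Real.sin (Real.pi / 2 / N) • p.2)
        - F p.1)) ^ 2 ∂((stdGaussian E).prod (stdGaussian E)) := by
  set γ := (stdGaussian E).prod (stdGaussian E)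
  set ε : ℝ := Real.pi / 2 / N with hε
  have hrot : ∀ θ, γ.map (ContinuousLinearMap.rotation θ) = γ := fun θ =>
    IsGaussian.map_rotation_eq_self (by simp) θ
  let Φ : E × E → ℝ := fun p => (F (Real.cos ε • p.1 + Real.sin ε • p.2) - F p.1) ^ 2
  have hFc := hF.continuous
  have hΦc : Continuous Φ := by fun_prop
  have hdom : Integrable (fun p : E × E => ‖p.1‖ ^ 2 + ‖p.2‖ ^ 2) γ :=
    (integrable_sq_norm_stdGaussian.comp_fst _).add (integrable_sq_norm_stdGaussian.comp_snd _)
  have hΦi : Integrable Φ γ := by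
    refine (hdom.const_mul (8 * (K : ℝ) ^ 2)).mono' hΦc.aestronglyMeasurable
      (.of_forall fun p => ?_)
    have h1 := hF.dist_le_mul (Real.cos ε • p.1 + Real.sin ε • p.2) p.1
    rw [Real.dist_eq, dist_eq_norm] at h1
    have h2 : ‖Real.cos ε • p.1 + Real.sin ε • p.2 - p.1‖ ≤ 2 * ‖p.1‖ + ‖p.2‖ := by
      refine (norm_sub_le _ _).trans ?_
      have := norm_add_le (Real.cos ε • p.1) (Real.sin ε • p.2)
      rw [norm_smul, norm_smul, Real.norm_eq_abs, Real.norm_eq_abs] at this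
      nlinarith [Real.abs_cos_le_one ε, Real.abs_sin_le_one ε, norm_nonneg p.1, norm_nonneg p.2]
    have h3 : |F (Real.cos ε • p.1 + Real.sin ε • p.2) - F p.1| ≤ K * (2 * ‖p.1‖ + ‖p.2‖) :=
      h1.trans (by gcongr)
    rw [Real.norm_eq_abs, abs_of_nonneg (sq_nonneg _)]
    change (F _ - F _) ^ 2 ≤ _
    rw [← sq_abs (F _ - F _)]
    calc _ ≤ (K * (2 * ‖p.1‖ + ‖p.2‖)) ^ 2 := by gcongr
      _ ≤ _ := by
        rw [mul_pow]
        have : (2 * ‖p.1‖ + ‖p.2‖) ^ 2 ≤ 8 * (‖p.1‖ ^ 2 + ‖p.2‖ ^ 2) := by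
          nlinarith [sq_nonneg (‖p.1‖ - ‖p.2‖), sq_nonneg ‖p.1‖, sq_nonneg ‖p.2‖]
        calc _ ≤ (K : ℝ) ^ 2 * (8 * (‖p.1‖ ^ 2 + ‖p.2‖ ^ 2)) := by gcongr
          _ = _ := by ring
  have hmp : ∀ θ, MeasurePreserving (ContinuousLinearMap.rotation θ : E × E → E × E) γ γ :=
    fun θ => ⟨(ContinuousLinearMap.rotation θ).continuous.measurable, hrot θ⟩
  have hΦri : ∀ θ, Integrable (fun p => Φ (ContinuousLinearMap.rotation θ p)) γ := fun θ =>
    (hmp θ).integrable_comp_of_integrable hΦi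
  have hΦr : ∀ θ, ∫ p, Φ (ContinuousLinearMap.rotation θ p) ∂γ = ∫ p, Φ p ∂γ := by
    intro θ
    conv_rhs => rw [← hrot θ]
    rw [integral_map (hmp θ).aemeasurable hΦc.aestronglyMeasurable]
  let G : E × E → ℕ → ℝ := fun p k =>
    F (Real.cos (k * ε) • p.1 + Real.sin (k * ε) • p.2)
  -- By the addition formulas, the `k`-th increment along the arc is the first increment evaluated
  -- at the pair rotated by `k * ε`; rotation invariance of `γ` then gives all increments the same
  -- law.
  have hstep : ∀ p k, (G p (k + 1) - G p k) ^ 2 =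
      Φ (ContinuousLinearMap.rotation (k * ε) p) := by
    intro p k
    have : Real.cos ((k + 1 : ℕ) * ε) • p.1 + Real.sin ((k + 1 : ℕ) * ε) • p.2 =
        Real.cos ε • (ContinuousLinearMap.rotation (k * ε) p).1 +
        Real.sin ε • (ContinuousLinearMap.rotation (k * ε) p).2 := by
      rw [ContinuousLinearMap.rotation_apply]
      push_cast
      rw [add_mul, one_mul, Real.cos_add, Real.sin_add]
      module
    simp only [Φ, G, this]
    rfl
  have hN0 : (N : ℝ) ≠ 0 := by exact_mod_cast hN
  have hNε : (N : ℝ) * ε = Real.pi / 2 := by rw [hε]; field_simp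
  -- Telescoping over the quarter circle from `p.1` to `p.2`, then Cauchy–Schwarz. This costs one
  -- factor `N`; the sum of `N` equal integrals supplies the second.
  have hpt : ∀ p : E × E, (F p.2 - F p.1) ^ 2 ≤
      N * ∑ k ∈ Finset.range N, Φ (ContinuousLinearMap.rotation (k * ε) p) := by
    intro p
    have h0 : G p 0 = F p.1 := by simp [G]
    have h1 : G p N = F p.2 := by simp [G, hNε]
    rw [← h0, ← h1, ← Finset.sum_range_sub]
    simp_rw [← hstep]
    simpa using sq_sum_le_card_mul_sum_sq (s := Finset.range N) (f := fun k => G p (k + 1) - G p k)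
  have hsum : Integrable (fun p => (N : ℝ) *
      ∑ k ∈ Finset.range N, Φ (ContinuousLinearMap.rotation (k * ε) p)) γ :=
    (integrable_finsetSum _ fun k _ => hΦri _).const_mul _
  calc _ ≤ ∫ p, (N : ℝ) * ∑ k ∈ Finset.range N, Φ (ContinuousLinearMap.rotation (k * ε) p) ∂γ :=
        integral_mono_of_nonneg (.of_forall fun _ => sq_nonneg _) hsum (.of_forall hpt)
    _ = _ := by
      rw [integral_const_mul, integral_finsetSum _ fun k _ => hΦri _]
      simp_rw [hΦr, mul_pow]
      rw [integral_const_mul]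
      simp [Φ]
      ring

open Filter Topology in
/-- Poincaré inequality for Lipschitz functions of a Gaussian vector, in symmetrised form. -/
theorem integral_sub_sq_stdGaussian_le {F : E → ℝ} {K : ℝ≥0} (hF : LipschitzWith K F) :
    ∫ p, (F p.2 - F p.1) ^ 2 ∂((stdGaussian E).prod (stdGaussian E)) ≤
      (Real.pi / 2) ^ 2 * (K : ℝ) ^ 2 := by
  set γ := (stdGaussian E).prod (stdGaussian E) with hγ
  have hFc := hF.continuous
  have hdom : Integrable (fun p : E × E => ‖p.1‖ ^ 2 + ‖p.2‖ ^ 2) γ :=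
    (integrable_sq_norm_stdGaussian.comp_fst _).add (integrable_sq_norm_stdGaussian.comp_snd _)
  have hdiff : ∀ᵐ p ∂γ, DifferentiableAt ℝ F p.1 := by
    have : ∀ᵐ x ∂(stdGaussian E), DifferentiableAt ℝ F x :=
      stdGaussian_absolutelyContinuous.ae_le (hF.ae_differentiableAt (μ := volume))
    exact Measure.quasiMeasurePreserving_fst.ae this
  have hcurve : ∀ p : E × E, HasDerivAt
      (fun θ : ℝ => Real.cos θ • p.1 + Real.sin θ • p.2) p.2 0 := by
    intro p
    have h1 := ((Real.hasDerivAt_cos 0).smul_const p.1).fun_add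
      ((Real.hasDerivAt_sin 0).smul_const p.2)
    simpa using h1
  have hseq : Tendsto (fun N : ℕ => Real.pi / 2 / (N : ℝ)) atTop (𝓝[≠] 0) := by
    refine tendsto_nhdsWithin_iff.2 ⟨tendsto_const_div_atTop_nhds_zero_nat _, ?_⟩
    filter_upwards [eventually_ge_atTop 1] with N hN
    have : (0 : ℝ) < N := by exact_mod_cast hN
    have := Real.pi_pos
    simp only [Set.mem_compl_iff, Set.mem_singleton_iff]
    positivity
  have hlim : Tendsto (fun N : ℕ => ∫ p, ((N : ℝ) *
      (F (Real.cos (Real.pi / 2 / N) • p.1 + Real.sin (Real.pi / 2 / N) • p.2)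
        - F p.1)) ^ 2 ∂γ) atTop (𝓝 (∫ p, (Real.pi / 2 * fderiv ℝ F p.1 p.2) ^ 2 ∂γ)) := by
    refine tendsto_integral_of_dominated_convergence
      (fun p => (K : ℝ) ^ 2 * (Real.pi / 2) ^ 2 * (2 * (‖p.1‖ ^ 2 + ‖p.2‖ ^ 2)))
      (fun N => by fun_prop) ((hdom.const_mul _).const_mul _) ?_ ?_
    · intro N
      refine .of_forall fun p => ?_
      -- Domination is required for every `N`; at `N = 0` the prefactor kills the integrand.
      rcases Nat.eq_zero_or_pos N with rfl | hN
      · simp; positivity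
      have hN' : (0 : ℝ) < N := by exact_mod_cast hN
      set ε : ℝ := Real.pi / 2 / N
      have hε0 : 0 ≤ ε := by have := Real.pi_pos; positivity
      have h1 := hF.dist_le_mul (Real.cos ε • p.1 + Real.sin ε • p.2) p.1
      rw [Real.dist_eq, dist_eq_norm] at h1
      have h2 : ‖Real.cos ε • p.1 + Real.sin ε • p.2 - p.1‖ ≤ ε * (‖p.1‖ + ‖p.2‖) := by
        have e : Real.cos ε • p.1 + Real.sin ε • p.2 - p.1 =
          (Real.cos ε - 1) • p.1 + Real.sin ε • p.2 := by module
        rw [e]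
        refine (norm_add_le _ _).trans ?_
        rw [norm_smul, norm_smul, Real.norm_eq_abs, Real.norm_eq_abs, mul_add]
        have hs : |Real.sin ε| ≤ ε := by
          have := Real.abs_sin_le_abs (x := ε)
          rwa [abs_of_nonneg hε0] at this
        have hc : |Real.cos ε - 1| ≤ ε := by
          have := Real.abs_cos_sub_cos_le (x := ε) (y := 0)
          simpa [abs_of_nonneg hε0] using this
        gcongr
      have h3 : |(N : ℝ) * (F (Real.cos ε • p.1 + Real.sin ε • p.2) - F p.1)| ≤
          K * (Real.pi / 2) * (‖p.1‖ + ‖p.2‖) := by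
        rw [abs_mul, abs_of_pos hN']
        calc _ ≤ (N : ℝ) * (K * (ε * (‖p.1‖ + ‖p.2‖))) := by
              gcongr; exact h1.trans (by gcongr)
          _ = _ := by simp only [ε]; field_simp
      rw [Real.norm_eq_abs, abs_of_nonneg (sq_nonneg _), ← sq_abs]
      calc _ ≤ (K * (Real.pi / 2) * (‖p.1‖ + ‖p.2‖)) ^ 2 := by gcongr
        _ ≤ _ := by
          rw [mul_pow, mul_pow]
          gcongr
          exact add_sq_le
    · filter_upwards [hdiff] with p hp
      have hd : HasDerivAt (fun θ : ℝ => F (Real.cos θ • p.1 + Real.sin θ • p.2))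
          (fderiv ℝ F p.1 p.2) 0 := by
        have h0 : p.1 = Real.cos 0 • p.1 + Real.sin 0 • p.2 := by simp
        have hp' := hp.hasFDerivAt
        exact HasFDerivAt.comp_hasDerivAt (f := fun θ : ℝ => Real.cos θ • p.1 + Real.sin θ • p.2)
          0 (by simpa using hp') (hcurve p)
      -- With `ε = π / 2 / N` one has `N = (π / 2) / ε`, so the rescaled increment is `π / 2` times
      -- a difference quotient at angle `0`.
      have hs := (hd.tendsto_slope.comp hseq).const_mul (Real.pi / 2)
      refine (hs.congr' ?_).pow 2
      filter_upwards [eventually_ge_atTop 1] with N hN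
      have hN' : (0 : ℝ) < N := by exact_mod_cast hN
      have := Real.pi_pos
      simp only [Function.comp, slope_def_field]
      simp
      field_simp
  have hle : ∫ p, (F p.2 - F p.1) ^ 2 ∂γ ≤ ∫ p, (Real.pi / 2 * fderiv ℝ F p.1 p.2) ^ 2 ∂γ := by
    refine ge_of_tendsto hlim ?_
    filter_upwards [eventually_ge_atTop 1] with N hN
    exact integral_sub_sq_le_of_rotation hF N (by omega)
  refine hle.trans ?_
  have hmeas : Measurable fun p : E × E => (Real.pi / 2 * fderiv ℝ F p.1 p.2) ^ 2 := by
    have h1 : Measurable fun p : E × E => fderiv ℝ F p.1 :=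
      (measurable_fderiv ℝ F).comp measurable_fst
    have h2 : Measurable fun p : E × E => fderiv ℝ F p.1 p.2 := by
      have hc : Continuous fun q : (E →L[ℝ] ℝ) × E => q.1 q.2 := by fun_prop
      exact hc.measurable.comp (h1.prodMk measurable_snd)
    exact (h2.const_mul _).pow_const 2
  have hnorm : ∀ x, ‖fderiv ℝ F x‖ ≤ K := fun x => norm_fderiv_le_of_lipschitz ℝ hF
  have hint : Integrable (fun p : E × E => (Real.pi / 2 * fderiv ℝ F p.1 p.2) ^ 2) γ := by
    refine ((hdom.const_mul ((K : ℝ) ^ 2 * (Real.pi / 2) ^ 2))).mono' hmeas.aestronglyMeasurable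
      (.of_forall fun p => ?_)
    rw [Real.norm_eq_abs, abs_of_nonneg (sq_nonneg _), mul_pow, ← sq_abs (fderiv ℝ F p.1 p.2)]
    have h1 : |fderiv ℝ F p.1 p.2| ≤ K * ‖p.2‖ :=
      ((fderiv ℝ F p.1).le_opNorm p.2).trans (by gcongr; exact hnorm _)
    calc _ ≤ (Real.pi / 2) ^ 2 * (K * ‖p.2‖) ^ 2 := by gcongr
      _ = (K : ℝ) ^ 2 * (Real.pi / 2) ^ 2 * (0 + ‖p.2‖ ^ 2) := by ring
      _ ≤ _ := by gcongr; positivity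
  -- For fixed first coordinate `x`, the inner integral is the second moment of the linear form `π /
  -- 2 • fderiv ℝ F x`, that is, its squared norm.
  rw [hγ, integral_prod _ hint]
  calc _ ≤ ∫ _ : E, (Real.pi / 2) ^ 2 * (K : ℝ) ^ 2 ∂(stdGaussian E) := by
        refine integral_mono hint.integral_prod_left (integrable_const _) fun x => ?_
        simp only [mul_pow]
        rw [integral_const_mul, integral_sq_strongDual_stdGaussian]
        gcongr
        exact hnorm x
    _ = _ := by simp

/-- The second moment of an odd Lipschitz function of a Gaussian vector is bounded independently of
the dimension. -/
theorem integral_sq_stdGaussian_le_of_odd {F : E → ℝ} {K : ℝ≥0} (hF : LipschitzWith K F)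
    (hodd : ∀ x, F (-x) = -F x) :
    Integrable (fun x => F x ^ 2) (stdGaussian E) ∧
    ∫ x, F x ^ 2 ∂(stdGaussian E) ≤ Real.pi ^ 2 / 8 * (K : ℝ) ^ 2 := by
  have hFc := hF.continuous
  have h0 : F 0 = 0 := by have := hodd 0; rw [neg_zero] at this; linarith
  have hb : ∀ x, |F x| ≤ K * ‖x‖ := fun x => by
    simpa [h0, Real.dist_eq] using hF.dist_le_mul x 0
  have hint : Integrable (fun x => F x ^ 2) (stdGaussian E) := by
    refine (integrable_sq_norm_stdGaussian.const_mul ((K : ℝ) ^ 2)).mono'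
      (by fun_prop) (.of_forall fun x => ?_)
    rw [Real.norm_eq_abs, abs_of_nonneg (sq_nonneg _), ← sq_abs, ← mul_pow]
    gcongr
    exact hb x
  refine ⟨hint, ?_⟩
  have hint1 : Integrable F (stdGaussian E) :=
    ((memLp_two_iff_integrable_sq hFc.aestronglyMeasurable).2 hint).integrable (by norm_num)
  have hmean : ∫ x, F x ∂(stdGaussian E) = 0 := by
    have hneg : (stdGaussian E).map (LinearIsometryEquiv.neg ℝ : E ≃ₗᵢ[ℝ] E) = stdGaussian E :=
      stdGaussian_map _
    have h1 : ∫ x, F x ∂(stdGaussian E) = ∫ x, F (-x) ∂(stdGaussian E) := by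
      conv_lhs => rw [← hneg]
      rw [integral_map (by fun_prop) hFc.aestronglyMeasurable]
      simp
    simp_rw [hodd] at h1
    rw [integral_neg] at h1
    linarith
  have hP := integral_sub_sq_stdGaussian_le hF
  -- The cross term vanishes because `F` has mean zero; the factor `2` turns `π² / 4` into `π² / 8`.
  have hexp : ∫ p, (F p.2 - F p.1) ^ 2 ∂((stdGaussian E).prod (stdGaussian E)) =
      2 * ∫ x, F x ^ 2 ∂(stdGaussian E) := by
    have e : ∀ p : E × E, (F p.2 - F p.1) ^ 2 =
        F p.1 ^ 2 + F p.2 ^ 2 - 2 * (F p.1 * F p.2) := fun p => by ring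
    simp_rw [e]
    rw [integral_sub ((hint.comp_fst _).fun_add (hint.comp_snd _))
      ((hint1.mul_prod hint1).const_mul 2),
      integral_add (hint.comp_fst _) (hint.comp_snd _), integral_const_mul,
      integral_prod_mul, hmean, integral_fun_fst (fun x => F x ^ 2),
      integral_fun_snd (fun x => F x ^ 2)]
    simp
    ring
  rw [hexp] at hP
  linarith

end Gaussian

/-! ### Transfer from Gaussian space to the unit sphere. -/

section Sphere

variable {E : Type*} [NormedAddCommGroup E] [InnerProductSpace ℝ E] [FiniteDimensional ℝ E]
  [MeasurableSpace E] [BorelSpace E]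

/-- Integration in polar coordinates of a product of a radial and an angular factor. -/
theorem lintegral_radial_mul_angular [Nontrivial E] {g : ℝ → ℝ≥0∞} (hg : Measurable g)
    {H : E → ℝ≥0∞} (hH : Measurable H) :
    ∫⁻ x : E, g ‖x‖ * H (‖x‖⁻¹ • x) =
      (∫⁻ s, H s.1 ∂(volume : Measure E).toSphere) *
        ∫⁻ r, g r.1 ∂(Measure.volumeIoiPow (Module.finrank ℝ E - 1)) := by
  have hmp := (volume : Measure E).measurePreserving_homeomorphUnitSphereProd
  calc ∫⁻ x : E, g ‖x‖ * H (‖x‖⁻¹ • x)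
      = ∫⁻ x in ({0}ᶜ : Set E), g ‖x‖ * H (‖x‖⁻¹ • x) := by
        rw [restrict_compl_singleton]
    _ = ∫⁻ x : ({0}ᶜ : Set E), g ‖x.1‖ * H (‖x.1‖⁻¹ • x.1) ∂(volume.comap Subtype.val) := by
        rw [lintegral_subtype_comap (measurableSet_singleton (0 : E)).compl
          (fun x => g ‖x‖ * H (‖x‖⁻¹ • x))]
    _ = ∫⁻ p, H p.1.1 * g p.2.1 ∂((volume : Measure E).toSphere.prod
          (Measure.volumeIoiPow (Module.finrank ℝ E - 1))) := by
        rw [← hmp.lintegral_comp (by fun_prop)]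
        refine lintegral_congr fun x => ?_
        rw [mul_comm]
        simp
    _ = _ := by
        rw [lintegral_prod_mul (f := fun s : Metric.sphere (0 : E) 1 => H s.1)
          (g := fun r : Set.Ioi (0 : ℝ) => g r.1)]
        · exact (hH.comp measurable_subtype_coe).aemeasurable
        · exact (hg.comp measurable_subtype_coe).aemeasurable

/-- Under the standard Gaussian measure, norm and direction are independent, and the direction is
uniformly distributed. -/
theorem lintegral_sq_norm_mul_angular_stdGaussian {d : ℕ} (hd : d ≠ 0)
    {H : EuclideanSpace ℝ (Fin d) → ℝ≥0∞} (hH : Measurable H) :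
    ∫⁻ x, ENNReal.ofReal (‖x‖ ^ 2) * H (‖x‖⁻¹ • x) ∂(stdGaussian (EuclideanSpace ℝ (Fin d))) =
      d * ∫⁻ s, H s.1 ∂(uniformSphere d) := by
  have : NeZero d := ⟨hd⟩
  let ρ : ℝ → ℝ≥0∞ := fun r => ENNReal.ofReal
    ((∫ y : EuclideanSpace ℝ (Fin d), Real.exp (-(1 / 2 : ℝ) * ‖y‖ ^ 2))⁻¹ *
        Real.exp (-(1 / 2 : ℝ) * r ^ 2))
  have hρ : Measurable ρ := by fun_prop
  have key : ∀ G : EuclideanSpace ℝ (Fin d) → ℝ≥0∞, Measurable G →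
      ∫⁻ x, ENNReal.ofReal (‖x‖ ^ 2) * G (‖x‖⁻¹ • x) ∂(stdGaussian (EuclideanSpace ℝ (Fin d))) =
      (∫⁻ s, G s.1 ∂(volume : Measure (EuclideanSpace ℝ (Fin d))).toSphere) *
        ∫⁻ r, ρ r.1 * ENNReal.ofReal (r.1 ^ 2) ∂(Measure.volumeIoiPow
          (Module.finrank ℝ (EuclideanSpace ℝ (Fin d)) - 1)) := by
    intro G hG
    rw [stdGaussian_eq_withDensity, lintegral_withDensity_eq_lintegral_mul _ (by fun_prop)
      (by fun_prop), ← lintegral_radial_mul_angular (g := fun r => ρ r * ENNReal.ofReal (r ^ 2))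
      (by fun_prop) hG]
    refine lintegral_congr fun x => ?_
    simp only [Pi.mul_apply, ρ]
    ring
  -- The case `G = 1` determines the radial factor from the total surface mass and `E‖x‖² = d`, with
  -- no explicit Gamma integrals.
  have h1 := key (fun _ => 1) measurable_const
  have h2 : ∫⁻ x, ENNReal.ofReal (‖x‖ ^ 2) ∂(stdGaussian (EuclideanSpace ℝ (Fin d))) = d := by
    rw [← ofReal_integral_eq_lintegral_ofReal integrable_sq_norm_stdGaussian
      (.of_forall fun _ => sq_nonneg _), integral_sq_norm_stdGaussian]
    simp
  simp only [mul_one, h2, lintegral_const, one_mul] at h1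
  have hS0 : (volume : Measure (EuclideanSpace ℝ (Fin d))).toSphere Set.univ ≠ 0 := by
    rw [Ne, Measure.measure_univ_eq_zero]
    exact Measure.toSphere_ne_zero _
  have hSt : (volume : Measure (EuclideanSpace ℝ (Fin d))).toSphere Set.univ ≠ ∞ :=
    measure_ne_top _ _
  rw [key H hH, uniformSphere, lintegral_smul_measure, h1, smul_eq_mul]
  set S := (volume : Measure (EuclideanSpace ℝ (Fin d))).toSphere Set.univ
  set I := ∫⁻ s, H s.1 ∂(volume : Measure (EuclideanSpace ℝ (Fin d))).toSphere
  set J := ∫⁻ r, ρ r.1 * ENNReal.ofReal (r.1 ^ 2) ∂(Measure.volumeIoiPow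
          (Module.finrank ℝ (EuclideanSpace ℝ (Fin d)) - 1))
  calc I * J = (S * S⁻¹) * (I * J) := by rw [ENNReal.mul_inv_cancel hS0 hSt, one_mul]
    _ = _ := by ring

omit [FiniteDimensional ℝ E] [MeasurableSpace E] [BorelSpace E] in
/-- The `1`-homogeneous extension of a bounded Lipschitz function on the unit sphere. -/
theorem lipschitzWith_norm_mul_comp_direction {h : E → ℝ} {K : ℝ≥0}
    (hh : LipschitzOnWith K h (Metric.sphere 0 1)) (hb : ∀ v ∈ Metric.sphere (0 : E) 1, |h v| ≤ K) :
    LipschitzWith (3 * K) fun x => ‖x‖ * h (‖x‖⁻¹ • x) := by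
  have hmem : ∀ x : E, x ≠ 0 → ‖x‖⁻¹ • x ∈ Metric.sphere (0 : E) 1 := by
    intro x hx
    simp [norm_smul, hx]
  refine LipschitzWith.of_dist_le_mul fun x y => ?_
  rw [Real.dist_eq, dist_eq_norm]
  push_cast
  have hK : (0 : ℝ) ≤ K := K.2
  rcases eq_or_ne x 0 with rfl | hx
  · rcases eq_or_ne y 0 with rfl | hy
    · simp
    · have := hb _ (hmem y hy)
      simp only [norm_zero, zero_mul, zero_sub, abs_neg, norm_neg, abs_mul, abs_norm]
      nlinarith [norm_nonneg y, mul_nonneg hK (norm_nonneg y)]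
  rcases eq_or_ne y 0 with rfl | hy
  · have := hb _ (hmem x hx)
    simp only [norm_zero, zero_mul, sub_zero, abs_mul, abs_norm]
    nlinarith [norm_nonneg x, mul_nonneg hK (norm_nonneg x)]
  have hx' : 0 < ‖x‖ := norm_pos_iff.2 hx
  have hy' : 0 < ‖y‖ := norm_pos_iff.2 hy
  have h1 := hh.dist_le_mul _ (hmem x hx) _ (hmem y hy)
  rw [Real.dist_eq, dist_eq_norm] at h1
  have h2 := hb _ (hmem x hx)
  have h3 : |‖x‖ - ‖y‖| ≤ ‖x - y‖ := abs_norm_sub_norm_le x y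
  -- Change of direction contributes `2K` and change of norm contributes `K`, whence the constant `3
  -- * K`.
  have h4 : ‖y‖ * ‖‖x‖⁻¹ • x - ‖y‖⁻¹ • y‖ ≤ 2 * ‖x - y‖ := by
    calc ‖y‖ * ‖‖x‖⁻¹ • x - ‖y‖⁻¹ • y‖ = ‖‖y‖ • (‖x‖⁻¹ • x - ‖y‖⁻¹ • y)‖ := by
          rw [norm_smul, norm_norm]
      _ = ‖(x - y) + ((‖y‖ - ‖x‖) * ‖x‖⁻¹) • x‖ := by
          congr 1
          rw [smul_sub, smul_smul, smul_smul, mul_inv_cancel₀ hy'.ne', sub_mul,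
            mul_inv_cancel₀ hx'.ne']
          module
      _ ≤ ‖x - y‖ + ‖((‖y‖ - ‖x‖) * ‖x‖⁻¹) • x‖ := norm_add_le _ _
      _ = ‖x - y‖ + |‖x‖ - ‖y‖| := by
          rw [norm_smul, norm_mul, norm_inv, norm_norm, mul_assoc, inv_mul_cancel₀ hx'.ne', mul_one,
            Real.norm_eq_abs, abs_sub_comm]
      _ ≤ _ := by linarith
  calc |‖x‖ * h (‖x‖⁻¹ • x) - ‖y‖ * h (‖y‖⁻¹ • y)|
      = |(‖x‖ - ‖y‖) * h (‖x‖⁻¹ • x) + ‖y‖ * (h (‖x‖⁻¹ • x) - h (‖y‖⁻¹ • y))| := by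
        congr 1; ring
    _ ≤ |‖x‖ - ‖y‖| * |h (‖x‖⁻¹ • x)| + ‖y‖ * |h (‖x‖⁻¹ • x) - h (‖y‖⁻¹ • y)| := by
        refine (abs_add_le _ _).trans ?_
        rw [abs_mul, abs_mul, abs_norm]
    _ ≤ ‖x - y‖ * K + ‖y‖ * (K * ‖‖x‖⁻¹ • x - ‖y‖⁻¹ • y‖) := by gcongr
    _ = ‖x - y‖ * K + K * (‖y‖ * ‖‖x‖⁻¹ • x - ‖y‖⁻¹ • y‖) := by ring
    _ ≤ ‖x - y‖ * K + K * (2 * ‖x - y‖) := by gcongr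
    _ = _ := by ring

/-- An odd `K`-Lipschitz function on the unit sphere of `ℝ^d` has second moment of order
`K ^ 2 / d`. -/
theorem integral_sq_uniformSphere_le_of_odd {d : ℕ} (hd : d ≠ 0)
    {h : EuclideanSpace ℝ (Fin d) → ℝ} {K : ℝ≥0}
    (hh : LipschitzOnWith K h (Metric.sphere 0 1))
    (hodd : ∀ v ∈ Metric.sphere (0 : EuclideanSpace ℝ (Fin d)) 1, h (-v) = -h v) :
    ∫ s, h s.1 ^ 2 ∂(uniformSphere d) ≤ 12 * (K : ℝ) ^ 2 / d := by
  obtain ⟨h', hh', heq⟩ := hh.extend_real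
  have hint : ∫ s, h s.1 ^ 2 ∂(uniformSphere d) = ∫ s, h' s.1 ^ 2 ∂(uniformSphere d) := by
    refine integral_congr_ae (.of_forall fun s => ?_)
    simp only [heq s.2]
  have hh'' : LipschitzOnWith K h' (Metric.sphere 0 1) := hh'.lipschitzOnWith
  have hodd' : ∀ v ∈ Metric.sphere (0 : EuclideanSpace ℝ (Fin d)) 1, h' (-v) = -h' v := by
    intro v hv
    rw [← heq hv, ← heq (by simpa using hv), hodd v hv]
  -- Oddness gives `2 |h' v| = |h' v - h' (-v)|`, and antipodal points are at distance `2`.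
  have hb : ∀ v ∈ Metric.sphere (0 : EuclideanSpace ℝ (Fin d)) 1, |h' v| ≤ K := by
    intro v hv
    have h1 := hh'.dist_le_mul v (-v)
    have hv' : ‖v‖ = 1 := by simpa using hv
    rw [hodd' v hv, Real.dist_eq, dist_eq_norm, sub_neg_eq_add, sub_neg_eq_add, ← two_mul,
      ← two_smul ℝ v, norm_smul, abs_mul, hv'] at h1
    norm_num at h1
    linarith
  have hL := lipschitzWith_norm_mul_comp_direction hh'' hb
  have hFodd : ∀ x : EuclideanSpace ℝ (Fin d),
      ‖-x‖ * h' (‖-x‖⁻¹ • -x) = -(‖x‖ * h' (‖x‖⁻¹ • x)) := by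
    intro x
    rcases eq_or_ne x 0 with rfl | hx
    · simp
    · rw [norm_neg, smul_neg, hodd' _ (by simp [norm_smul, hx])]
      ring
  obtain ⟨hFi, hF⟩ := integral_sq_stdGaussian_le_of_odd hL hFodd
  have hc := hh'.continuous
  have hpol := lintegral_sq_norm_mul_angular_stdGaussian hd
    (H := fun v => ENNReal.ofReal (h' v ^ 2)) (by fun_prop)
  have e : ∀ x : EuclideanSpace ℝ (Fin d),
      ENNReal.ofReal (‖x‖ ^ 2) * ENNReal.ofReal (h' (‖x‖⁻¹ • x) ^ 2) =
      ENNReal.ofReal ((‖x‖ * h' (‖x‖⁻¹ • x)) ^ 2) := fun x => by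
    rw [← ENNReal.ofReal_mul (sq_nonneg _), mul_pow]
  simp only [e] at hpol
  have h3 := congrArg ENNReal.toReal hpol
  rw [← integral_eq_lintegral_of_nonneg_ae (.of_forall fun _ => sq_nonneg _)
    hFi.aestronglyMeasurable, ENNReal.toReal_mul, ← integral_eq_lintegral_of_nonneg_ae
    (.of_forall fun _ => sq_nonneg _) (by fun_prop), ENNReal.toReal_natCast] at h3
  have hd' : (0 : ℝ) < d := by positivity
  rw [hint, le_div_iff₀ hd', mul_comm, ← h3]
  refine hF.trans ?_
  -- The constant to absorb is `9 π² / 8`, about `11.1`, which is below `12`.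
  have hpi : Real.pi ^ 2 ≤ 3.15 ^ 2 := by
    have := Real.pi_lt_d2
    have := Real.pi_pos
    gcongr
  push_cast
  nlinarith [mul_nonneg (sub_nonneg.2 hpi) (sq_nonneg (K : ℝ)), sq_nonneg (K : ℝ)]

end Sphere

/-! ### Euclidean projection onto a closed convex set. -/

section Projection

variable {d : ℕ} {X : Set (EuclideanSpace ℝ (Fin d))}

theorem euclideanProj_spec (hcl : IsClosed X) (hne : X.Nonempty) (y : EuclideanSpace ℝ (Fin d)) :
    euclideanProj X y ∈ X ∧ ∀ z ∈ X, ‖y - euclideanProj X y‖ ≤ ‖y - z‖ := by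
  obtain ⟨p, hp, hpy⟩ := hcl.exists_infDist_eq_dist hne y
  refine Classical.epsilon_spec (p := fun p => p ∈ X ∧ ∀ z ∈ X, ‖y - p‖ ≤ ‖y - z‖)
    ⟨p, hp, fun z hz => ?_⟩
  rw [← dist_eq_norm, ← dist_eq_norm, ← hpy]
  exact Metric.infDist_le_dist_of_mem hz

theorem inner_sub_euclideanProj_le_zero (hcv : Convex ℝ X) (hcl : IsClosed X) (hne : X.Nonempty)
    (y : EuclideanSpace ℝ (Fin d)) {z : EuclideanSpace ℝ (Fin d)} (hz : z ∈ X) :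
    inner ℝ (y - euclideanProj X y) (z - euclideanProj X y) ≤ 0 := by
  obtain ⟨hp, hmin⟩ := euclideanProj_spec hcl hne y
  have : Nonempty X := hne.to_subtype
  refine (norm_eq_iInf_iff_real_inner_le_zero hcv hp).1 (le_antisymm ?_ ?_) z hz
  · exact le_ciInf fun w => hmin w w.2
  · exact ciInf_le ⟨0, by rintro _ ⟨w, rfl⟩; exact norm_nonneg _⟩
      (⟨euclideanProj X y, hp⟩ : X)

/-- Adding the variational inequalities at the two projections `p`, `q` gives `‖p - q‖² ≤ ⟪y - z, p
- q⟫`; Cauchy–Schwarz concludes. This controls the movement of the iterates and also yields their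
measurability. -/
theorem norm_euclideanProj_sub_le (hcv : Convex ℝ X) (hcl : IsClosed X) (hne : X.Nonempty)
    (y z : EuclideanSpace ℝ (Fin d)) :
    ‖euclideanProj X y - euclideanProj X z‖ ≤ ‖y - z‖ := by
  have h1 := inner_sub_euclideanProj_le_zero hcv hcl hne y (euclideanProj_spec hcl hne z).1
  have h2 := inner_sub_euclideanProj_le_zero hcv hcl hne z (euclideanProj_spec hcl hne y).1
  set p := euclideanProj X y
  set q := euclideanProj X z
  have h3 : inner ℝ (p - q) (p - q) ≤ inner ℝ (y - z) (p - q) := by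
    have e : inner ℝ (y - z) (p - q) - inner ℝ (p - q) (p - q) =
        -inner ℝ (y - p) (q - p) - inner ℝ (z - q) (p - q) := by
      rw [← neg_sub p q, inner_neg_right, neg_neg, ← inner_sub_left, ← inner_sub_left]
      congr 1
      abel
    linarith
  have h4 := real_inner_le_norm (y - z) (p - q)
  rw [real_inner_self_eq_norm_sq] at h3
  rcases (norm_nonneg (p - q)).eq_or_lt with h | h
  · rw [← h]; exact norm_nonneg _
  · nlinarith

theorem euclideanProj_of_mem (hcl : IsClosed X) {x : EuclideanSpace ℝ (Fin d)} (hx : x ∈ X) :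
    euclideanProj X x = x := by
  have h := (euclideanProj_spec hcl ⟨x, hx⟩ x).2 x hx
  rw [sub_self, norm_zero, norm_le_zero_iff, sub_eq_zero] at h
  exact h.symm

theorem measurable_euclideanProj (hcv : Convex ℝ X) (hcl : IsClosed X) (hne : X.Nonempty) :
    Measurable (euclideanProj X) := by
  have : LipschitzWith 1 (euclideanProj X) := LipschitzWith.of_dist_le_mul fun y z => by
    simpa [dist_eq_norm] using norm_euclideanProj_sub_le hcv hcl hne y z
  exact this.continuous.measurable

end Projection

/-! ### Deterministic and spherical bounds on the estimators. -/

section Estimators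

variable {d : ℕ} {X : Set (EuclideanSpace ℝ (Fin d))} {δ : ℝ}
  {f f' : EuclideanSpace ℝ (Fin d) → ℝ} {x x' v v' : EuclideanSpace ℝ (Fin d)} {L : ℝ≥0}

theorem add_smul_mem_cthickening (hδ : 0 ≤ δ) (hx : x ∈ X) (hv : ‖v‖ = 1) :
    x + δ • v ∈ Metric.cthickening δ X := by
  refine Metric.mem_cthickening_of_dist_le _ x δ X hx ?_
  simp [dist_eq_norm, norm_smul, hv, abs_of_nonneg hδ]

theorem sub_smul_mem_cthickening (hδ : 0 ≤ δ) (hx : x ∈ X) (hv : ‖v‖ = 1) :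
    x - δ • v ∈ Metric.cthickening δ X := by
  simpa [sub_eq_add_neg] using add_smul_mem_cthickening hδ hx (v := -v) (by simpa using hv)

/-- The worst-case bound, a factor `√d` above the root-mean-square order. It serves for
integrability and as the invariant of method `a` in the tuned regime. -/
theorem norm_twoPointEstimator_le (hδ : 0 < δ) (hf : LipschitzOnWith L f (Metric.cthickening δ X))
    (hx : x ∈ X) (hv : ‖v‖ = 1) : ‖twoPointEstimator δ f x v‖ ≤ d * L := by
  have h := hf.dist_le_mul _ (add_smul_mem_cthickening hδ.le hx hv) _
    (sub_smul_mem_cthickening hδ.le hx hv)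
  have e : x + δ • v - (x - δ • v) = (2 * δ) • v := by module
  rw [Real.dist_eq, dist_eq_norm, e, norm_smul, hv, mul_one, Real.norm_eq_abs,
    abs_of_pos (a := 2 * δ) (by positivity)] at h
  rw [twoPointEstimator, norm_smul, hv, mul_one, Real.norm_eq_abs, abs_mul,
    abs_of_nonneg (by positivity)]
  calc _ ≤ (d : ℝ) / (2 * δ) * (L * (2 * δ)) := by gcongr
    _ = _ := by field_simp

/-- The two-point estimator in a uniformly random direction has second moment of order
`d * L ^ 2`. -/
theorem integral_sq_norm_twoPointEstimator_le (hd : d ≠ 0) (hδ : 0 < δ)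
    (hf : LipschitzOnWith L f (Metric.cthickening δ X)) (hx : x ∈ X) :
    ∫ s, ‖twoPointEstimator δ f x s.1‖ ^ 2 ∂(uniformSphere d) ≤ 12 * d * (L : ℝ) ^ 2 := by
  have hnorm : ∀ s : Metric.sphere (0 : EuclideanSpace ℝ (Fin d)) 1, ‖s.1‖ = 1 := fun s => by simp
  set h : EuclideanSpace ℝ (Fin d) → ℝ := fun v => f (x + δ • v) - f (x - δ • v) with hh
  -- Each of the two evaluations contributes `δ * L`; the resulting `δ²` cancels the `δ⁻²` of the
  -- estimator.
  have hL : LipschitzOnWith (2 * δ.toNNReal * L) h (Metric.sphere 0 1) := by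
    refine LipschitzOnWith.of_dist_le_mul fun v hv w hw => ?_
    have hv' : ‖v‖ = 1 := by simpa using hv
    have hw' : ‖w‖ = 1 := by simpa using hw
    have h1 := hf.dist_le_mul _ (add_smul_mem_cthickening hδ.le hx hv') _
      (add_smul_mem_cthickening hδ.le hx hw')
    have h2 := hf.dist_le_mul _ (sub_smul_mem_cthickening hδ.le hx hv') _
      (sub_smul_mem_cthickening hδ.le hx hw')
    have e1 : x + δ • v - (x + δ • w) = δ • (v - w) := by module
    have e2 : x - δ • v - (x - δ • w) = -(δ • (v - w)) := by module
    rw [dist_eq_norm (x + _), e1, norm_smul, Real.norm_eq_abs, abs_of_pos hδ, Real.dist_eq] at h1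
    rw [dist_eq_norm (x - _), e2, norm_neg, norm_smul, Real.norm_eq_abs, abs_of_pos hδ,
      Real.dist_eq] at h2
    rw [Real.dist_eq, dist_eq_norm]
    push_cast
    rw [Real.coe_toNNReal _ hδ.le]
    calc |h v - h w| = |(f (x + δ • v) - f (x + δ • w)) - (f (x - δ • v) - f (x - δ • w))| := by
          simp only [hh]; congr 1; ring
      _ ≤ _ := abs_sub _ _
      _ ≤ _ := add_le_add h1 h2
      _ = _ := by ring
  have hodd : ∀ v ∈ Metric.sphere (0 : EuclideanSpace ℝ (Fin d)) 1, h (-v) = -h v := by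
    intro v _
    simp only [hh, smul_neg, sub_neg_eq_add, ← sub_eq_add_neg]
    ring
  have key := integral_sq_uniformSphere_le_of_odd hd hL hodd
  have e : ∀ s : Metric.sphere (0 : EuclideanSpace ℝ (Fin d)) 1,
      ‖twoPointEstimator δ f x s.1‖ ^ 2 = ((d : ℝ) / (2 * δ)) ^ 2 * h s.1 ^ 2 := by
    intro s
    rw [twoPointEstimator, norm_smul, hnorm, mul_one, Real.norm_eq_abs, sq_abs, mul_pow]
  simp_rw [e]
  rw [integral_const_mul]
  have hd' : (d : ℝ) ≠ 0 := by exact_mod_cast hd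
  push_cast at key
  rw [Real.coe_toNNReal _ hδ.le] at key
  calc _ ≤ ((d : ℝ) / (2 * δ)) ^ 2 * (12 * (2 * δ * L) ^ 2 / d) := by gcongr
    _ = _ := by field_simp

theorem norm_residualEstimator (hδ : 0 < δ) (hv : ‖v‖ = 1) :
    ‖residualEstimator δ f f' x v x' v'‖ =
      d / δ * |f (x + δ • v) - f' (x' + δ • v')| := by
  rw [residualEstimator, norm_smul, hv, mul_one, Real.norm_eq_abs, abs_mul,
    abs_of_nonneg (by positivity)]

/-- At `b = 0` the conventions `r / 0 = ∞` and `0 / 0 = 0` matter: a finite threshold then forces `a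
= 0`. -/
theorem abs_le_mul_of_ofReal_div_le {a b c : ℝ} (hb : 0 ≤ b) (hc : 0 ≤ c)
    (h : ENNReal.ofReal |a| / ENNReal.ofReal b ≤ ENNReal.ofReal c) : |a| ≤ c * b := by
  have h1 : ENNReal.ofReal |a| ≤ ENNReal.ofReal c * ENNReal.ofReal b := by
    rcases hb.eq_or_lt with rfl | hb'
    · rw [ENNReal.ofReal_zero, mul_zero, nonpos_iff_eq_zero]
      by_contra h0
      rw [ENNReal.ofReal_zero, ENNReal.div_zero h0] at h
      exact ENNReal.ofReal_ne_top (top_le_iff.1 h)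
    · exact (ENNReal.div_le_iff (by simpa using hb') ENNReal.ofReal_ne_top).1 h
  rw [← ENNReal.ofReal_mul hc] at h1
  exact (ENNReal.ofReal_le_ofReal_iff (by positivity)).1 h1

/-- A residual that passes the test is at most `D` times the distance of the query points, and two
unit directions add at most `2 * δ` to that of the iterates. -/
theorem norm_lazyEstimator_temporalVariationA {D : ℝ} (hδ : 0 < δ) (hD : 0 ≤ D)
    (hv : ‖v‖ = 1) (hv' : ‖v'‖ = 1) :
    ‖lazyEstimator temporalVariationA δ D f f' x v x' v'‖ ≤ d / δ * (D * (‖x - x'‖ + 2 * δ)) ∨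
    lazyEstimator temporalVariationA δ D f f' x v x' v' = twoPointEstimator δ f x v := by
  unfold lazyEstimator
  split_ifs with h
  · left
    have h1 := abs_le_mul_of_ofReal_div_le (norm_nonneg _) hD h
    have h2 : ‖x + δ • v - (x' + δ • v')‖ ≤ ‖x - x'‖ + 2 * δ := by
      have e : x + δ • v - (x' + δ • v') = (x - x') + δ • (v - v') := by module
      rw [e]
      refine (norm_add_le _ _).trans ?_
      have := norm_sub_le v v'
      rw [norm_smul, Real.norm_eq_abs, abs_of_pos hδ]
      nlinarith
    rw [norm_residualEstimator hδ hv]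
    gcongr
    exact h1.trans (by gcongr)
  · exact .inr rfl

theorem norm_lazyEstimator_temporalVariationB {D η : ℝ} (hδ : 0 < δ) (hD : 0 ≤ D) (hη : 0 ≤ η)
    (hv : ‖v‖ = 1) :
    ‖lazyEstimator (temporalVariationB η L) δ D f f' x v x' v'‖ ≤ d / δ * (D * (η * L)) ∨
    lazyEstimator (temporalVariationB η L) δ D f f' x v x' v' = twoPointEstimator δ f x v := by
  unfold lazyEstimator
  split_ifs with h
  · left
    have h1 := abs_le_mul_of_ofReal_div_le (by positivity) hD h
    rw [norm_residualEstimator hδ hv]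
    gcongr
  · exact .inr rfl

end Estimators

/-! ### Joint measurability of random continuous losses. -/

section Measurability

variable {d : ℕ}

/-- A Carathéodory function, measurable in `ω` and continuous in the point, is jointly measurable.
The map `a` lets the evaluation live on another space: the same `Ω` with a finer σ-algebra, or a
product with the sphere. -/
theorem measurable_eval_of_continuousOn {Ω Ω' : Type*} {_ : MeasurableSpace Ω}
    {_ : MeasurableSpace Ω'} {Y : Set (EuclideanSpace ℝ (Fin d))}
    {f : Ω → EuclideanSpace ℝ (Fin d) → ℝ} (hf : ∀ x ∈ Y, Measurable fun ω => f ω x)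
    (hc : ∀ ω, ContinuousOn (f ω) Y) {a : Ω' → Ω} (ha : Measurable a)
    {z : Ω' → EuclideanSpace ℝ (Fin d)} (hz : Measurable z) (hzY : ∀ ω, z ω ∈ Y) :
    Measurable fun ω => f (a ω) (z ω) := by
  have h := measurable_uncurry_of_continuous_of_measurable (u := fun (y : Y) ω => f ω y)
    (fun ω => (hc ω).domRestrict) (fun y => hf y y.2)
  exact h.comp ((hz.subtype_mk (h := hzY)).prodMk ha)

theorem measurable_twoPointEstimator {Ω Ω' : Type*} {_ : MeasurableSpace Ω}
    {_ : MeasurableSpace Ω'} {X : Set (EuclideanSpace ℝ (Fin d))} {δ : ℝ} (hδ : 0 ≤ δ)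
    {f : Ω → EuclideanSpace ℝ (Fin d) → ℝ}
    (hf : ∀ x ∈ Metric.cthickening δ X, Measurable fun ω => f ω x)
    (hc : ∀ ω, ContinuousOn (f ω) (Metric.cthickening δ X)) {a : Ω' → Ω} (ha : Measurable a)
    {x v : Ω' → EuclideanSpace ℝ (Fin d)} (hx : Measurable x) (hv : Measurable v)
    (hxX : ∀ ω, x ω ∈ X) (hv1 : ∀ ω, ‖v ω‖ = 1) :
    Measurable fun ω => twoPointEstimator δ (f (a ω)) (x ω) (v ω) := by
  have h1 := measurable_eval_of_continuousOn hf hc ha (z := fun ω => x ω + δ • v ω)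
    (by fun_prop) fun ω => add_smul_mem_cthickening hδ (hxX ω) (hv1 ω)
  have h2 := measurable_eval_of_continuousOn hf hc ha (z := fun ω => x ω - δ • v ω)
    (by fun_prop) fun ω => sub_smul_mem_cthickening hδ (hxX ω) (hv1 ω)
  exact ((h1.sub h2).const_mul _).smul hv

end Measurability

/-! ### Conditional expectations: freezing, domination and the tower property. -/

section CondExp

variable {Ω S : Type*} {m m' mΩ : MeasurableSpace Ω} [MeasurableSpace S] {μ : Measure Ω}
  [IsProbabilityMeasure μ]

/-- Conditional expectation of a function of independent random variables, given the first one. -/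
theorem condExp_prod_ae_eq_integral_of_indepFun {Ω' : Type*} {mΩ' : MeasurableSpace Ω'}
    {Z : Ω → Ω'} {U : Ω → S} (hZ : Measurable Z) (hU : Measurable U) (hind : IndepFun Z U μ)
    {φ : Ω' × S → ℝ} (hφ : Measurable φ) (hint : Integrable (fun ω => φ (Z ω, U ω)) μ) :
    μ[fun ω => φ (Z ω, U ω) | mΩ'.comap Z] =ᵐ[μ] fun ω => ∫ s, φ (Z ω, s) ∂(μ.map U) := by
  have : IsProbabilityMeasure (μ.map U) := Measure.isProbabilityMeasure_map hU.aemeasurable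
  have : IsProbabilityMeasure (μ.map Z) := Measure.isProbabilityMeasure_map hZ.aemeasurable
  have hmap := (indepFun_iff_map_prod_eq_prod_map_map hZ.aemeasurable hU.aemeasurable).1 hind
  have hint' : Integrable φ ((μ.map Z).prod (μ.map U)) := by
    rw [← hmap, integrable_map_measure hφ.aestronglyMeasurable (hZ.prodMk hU).aemeasurable]
    exact hint
  have hsm : StronglyMeasurable fun z => ∫ s, φ (z, s) ∂(μ.map U) :=
    hφ.stronglyMeasurable.integral_prod_right'
  have hgi : Integrable (fun ω => ∫ s, φ (Z ω, s) ∂(μ.map U)) μ :=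
    hint'.integral_prod_left.comp_measurable hZ
  refine (ae_eq_condExp_of_forall_setIntegral_eq hZ.comap_le hint
    (fun s _ _ => hgi.integrableOn) ?_ ?_).symm
  · rintro s ⟨B, hB, rfl⟩ -
    have e1 : ∫ ω in Z ⁻¹' B, φ (Z ω, U ω) ∂μ =
        ∫ p in B ×ˢ Set.univ, φ p ∂((μ.map Z).prod (μ.map U)) := by
      rw [← hmap, setIntegral_map (hB.prod .univ) hφ.aestronglyMeasurable
        (hZ.prodMk hU).aemeasurable]
      congr 2
      ext ω
      simp
    have e2 : ∫ ω in Z ⁻¹' B, (∫ s, φ (Z ω, s) ∂(μ.map U)) ∂μ =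
        ∫ z in B, (∫ s, φ (z, s) ∂(μ.map U)) ∂(μ.map Z) := by
      rw [setIntegral_map hB hsm.aestronglyMeasurable hZ.aemeasurable]
    rw [e1, e2, setIntegral_prod _ hint'.integrableOn, Measure.restrict_univ]
  · exact (hsm.comp_measurable (comap_measurable Z)).aestronglyMeasurable

/-- The σ-algebra `m` is generated by the identity viewed as a random variable with values in `(Ω,
m)`, which reduces the claim to the case of two independent variables. -/
theorem condExp_prod_ae_le_of_indep (hm : m ≤ mΩ) {U : Ω → S}
    (hU : Measurable U) (hind : Indep (MeasurableSpace.comap U inferInstance) m μ)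
    {φ : Ω × S → ℝ} (hφ : Measurable[m.prod inferInstance] φ)
    (hint : Integrable (fun ω => φ (ω, U ω)) μ) {C : ℝ}
    (hC : ∀ ω, ∫ s, φ (ω, s) ∂(μ.map U) ≤ C) :
    μ[fun ω => φ (ω, U ω) | m] ≤ᵐ[μ] fun _ => C := by
  have hid : @Measurable Ω Ω mΩ m id := fun s hs => hm s hs
  have hind' : @IndepFun Ω Ω S mΩ m _ id U μ :=
    (@IndepFun_iff_Indep Ω Ω S mΩ m _ id U μ).2 (by
      rw [MeasurableSpace.comap_id]
      exact hind.symm)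
  have h := condExp_prod_ae_eq_integral_of_indepFun (mΩ' := m) (Z := id) hid hU hind' hφ hint
  rw [MeasurableSpace.comap_id] at h
  filter_upwards [h] with ω hω
  exact hω.trans_le (hC ω)

/-- Replaces "one of two alternatives" by a sum, so the event on which the residual is used, which
depends on the fresh direction, need not be conditioned on. -/
theorem condExp_ae_le_add_of_le_add (hm : m ≤ mΩ) {Y A Z : Ω → ℝ} {C : ℝ}
    (hY : Integrable Y μ) (hA : Integrable A μ) (hAm : StronglyMeasurable[m] A)
    (hZ : Integrable Z μ) (hle : ∀ ω, Y ω ≤ A ω + Z ω) (hC : μ[Z | m] ≤ᵐ[μ] fun _ => C) :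
    μ[Y | m] ≤ᵐ[μ] fun ω => A ω + C := by
  have h1 := condExp_mono (m := m) hY (hA.add hZ) (.of_forall hle)
  have h2 := condExp_add hA hZ m
  rw [condExp_of_stronglyMeasurable hm hAm hA] at h2
  filter_upwards [h1, h2, hC] with ω a b c
  rw [b] at a
  simp only [Pi.add_apply] at a
  linarith

/-- An affine bound on a conditional expectation passes to a smaller σ-algebra. -/
theorem condExp_ae_le_affine_of_le (hmm : m ≤ m') (hm' : m' ≤ mΩ)
    {Y W : Ω → ℝ} {a k b : ℝ} (hW : Integrable W μ)
    (h : μ[Y | m'] ≤ᵐ[μ] fun ω => a + k * W ω + b) :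
    μ[Y | m] ≤ᵐ[μ] fun ω => a + k * (μ[W | m]) ω + b := by
  have hm := hmm.trans hm'
  have hi : Integrable (fun ω => (a + b) + k * W ω) μ :=
    (integrable_const _).add (hW.const_mul k)
  have h' : μ[Y | m'] ≤ᵐ[μ] fun ω => (a + b) + k * W ω := by
    filter_upwards [h] with ω hω
    linarith
  have h1 := condExp_mono (m := m) integrable_condExp hi h'
  have h2 := condExp_condExp_of_le (μ := μ) (f := Y) hmm hm'
  have h3 : μ[fun ω => (a + b) + k * W ω | m] =ᵐ[μ] μ[fun _ => a + b | m] + μ[fun ω => k * W ω | m] :=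
    condExp_add (integrable_const _) (hW.const_mul k) m
  have h4 : μ[fun ω => k * W ω | m] =ᵐ[μ] k • μ[W | m] := condExp_smul k W m
  filter_upwards [h1, h2, h3, h4] with ω e1 e2 e3 e4
  rw [e2, e3, Pi.add_apply, e4, condExp_const hm] at e1
  simp only [Pi.smul_apply, smul_eq_mul] at e1
  linarith

theorem condExp_ae_le_const_of_le (hmm : m ≤ m') (hm' : m' ≤ mΩ)
    {Y : Ω → ℝ} {a : ℝ} (h : μ[Y | m'] ≤ᵐ[μ] fun _ => a) : μ[Y | m] ≤ᵐ[μ] fun _ => a := by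
  have h1 := condExp_mono (m := m) integrable_condExp (integrable_const a) h
  have h2 := condExp_condExp_of_le (μ := μ) (f := Y) hmm hm'
  filter_upwards [h1, h2] with ω e1 e2
  rwa [e2, condExp_const (hmm.trans hm')] at e1

end CondExp

/-! ### The lazy process: adaptedness and the two-point moment, common to both variations. -/

/-- A lazy zeroth-order method with temporal variation `V`, run up to time `T` on random losses
that are `L`-Lipschitz near `X` and determined by the past, with directions that are uniform on the
sphere and independent of the past. -/
structure IsLazyProcess {d : ℕ} {Ω : Type*} {mΩ : MeasurableSpace Ω}
    (V : (EuclideanSpace ℝ (Fin d) → ℝ) → (EuclideanSpace ℝ (Fin d) → ℝ) →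
      EuclideanSpace ℝ (Fin d) → EuclideanSpace ℝ (Fin d) → ℝ≥0∞)
    (T : ℕ) (μ : Measure Ω) (ℱ : Filtration ℕ mΩ)
    (u : ℕ → Ω → Metric.sphere (0 : EuclideanSpace ℝ (Fin d)) 1)
    (X : Set (EuclideanSpace ℝ (Fin d))) (x₀ : EuclideanSpace ℝ (Fin d)) (η δ D : ℝ) (L : ℝ≥0)
    (f : ℕ → Ω → EuclideanSpace ℝ (Fin d) → ℝ)
    (x g : ℕ → Ω → EuclideanSpace ℝ (Fin d)) : Prop where
  measurable_dir : ∀ t ≤ T, Measurable[ℱ (t + 1)] (u t)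
  law_dir : ∀ t ≤ T, μ.map (u t) = uniformSphere d
  indep_dir : ∀ t ≤ T, Indep (MeasurableSpace.comap (u t) inferInstance) (ℱ t) μ
  convex : Convex ℝ X
  closed : IsClosed X
  mem : x₀ ∈ X
  eta_pos : 0 < η
  delta_pos : 0 < δ
  threshold_pos : 0 < D
  measurable_loss : ∀ t ≤ T, ∀ x ∈ Metric.cthickening δ X, Measurable[ℱ t] (fun ω => f t ω x)
  lipschitz_loss : ∀ t ≤ T, ∀ ω, LipschitzOnWith L (f t ω) (Metric.cthickening δ X)
  run : ∀ t ω, (x t ω, g t ω) = lazoRun V X x₀ η δ D (fun s => f s ω) (fun s => (u s ω).1) t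

namespace IsLazyProcess

variable {d : ℕ} {Ω : Type*} {mΩ : MeasurableSpace Ω}
    {V : (EuclideanSpace ℝ (Fin d) → ℝ) → (EuclideanSpace ℝ (Fin d) → ℝ) →
      EuclideanSpace ℝ (Fin d) → EuclideanSpace ℝ (Fin d) → ℝ≥0∞}
    {T : ℕ} {μ : Measure Ω} {ℱ : Filtration ℕ mΩ}
    {u : ℕ → Ω → Metric.sphere (0 : EuclideanSpace ℝ (Fin d)) 1}
    {X : Set (EuclideanSpace ℝ (Fin d))} {x₀ : EuclideanSpace ℝ (Fin d)} {η δ D : ℝ} {L : ℝ≥0}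
    {f : ℕ → Ω → EuclideanSpace ℝ (Fin d) → ℝ}
    {x g : ℕ → Ω → EuclideanSpace ℝ (Fin d)}

theorem iterate_zero (h : IsLazyProcess V T μ ℱ u X x₀ η δ D L f x g) (ω : Ω) : x 0 ω = x₀ :=
  (Prod.ext_iff.1 (h.run 0 ω)).1

theorem estimate_zero (h : IsLazyProcess V T μ ℱ u X x₀ η δ D L f x g) (ω : Ω) :
    g 0 ω = twoPointEstimator δ (f 0 ω) (x 0 ω) (u 0 ω) := by
  rw [h.iterate_zero]
  exact (Prod.ext_iff.1 (h.run 0 ω)).2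

theorem iterate_succ (h : IsLazyProcess V T μ ℱ u X x₀ η δ D L f x g) (t : ℕ) (ω : Ω) :
    x (t + 1) ω = euclideanProj X (x t ω - η • g t ω) := by
  have h1 := (Prod.ext_iff.1 (h.run (t + 1) ω)).1
  rw [lazoRun, ← h.run t ω] at h1
  exact h1

theorem estimate_succ (h : IsLazyProcess V T μ ℱ u X x₀ η δ D L f x g) (t : ℕ) (ω : Ω) :
    g (t + 1) ω = lazyEstimator V δ D (f (t + 1) ω) (f t ω) (x (t + 1) ω) (u (t + 1) ω)
      (x t ω) (u t ω) := by
  rw [h.iterate_succ]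
  have h1 := (Prod.ext_iff.1 (h.run (t + 1) ω)).2
  rw [lazoRun, ← h.run t ω] at h1
  exact h1

theorem iterate_mem (h : IsLazyProcess V T μ ℱ u X x₀ η δ D L f x g) (t : ℕ) (ω : Ω) :
    x t ω ∈ X := by
  cases t with
  | zero => rw [h.iterate_zero]; exact h.mem
  | succ t =>
    rw [h.iterate_succ]
    exact (euclideanProj_spec h.closed ⟨x₀, h.mem⟩ _).1

theorem norm_iterate_sub_le (h : IsLazyProcess V T μ ℱ u X x₀ η δ D L f x g) (t : ℕ) (ω : Ω) :
    ‖x (t + 1) ω - x t ω‖ ≤ η * ‖g t ω‖ := by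
  have h1 := norm_euclideanProj_sub_le h.convex h.closed ⟨x₀, h.mem⟩ (x t ω - η • g t ω) (x t ω)
  rw [euclideanProj_of_mem h.closed (h.iterate_mem t ω), ← h.iterate_succ, sub_sub_cancel_left,
    norm_neg, norm_smul, Real.norm_eq_abs, abs_of_pos h.eta_pos] at h1
  exact h1

theorem norm_dir (u : ℕ → Ω → Metric.sphere (0 : EuclideanSpace ℝ (Fin d)) 1) (t : ℕ) (ω : Ω) :
    ‖(u t ω).1‖ = 1 := by simp

theorem norm_twoPoint_le (h : IsLazyProcess V T μ ℱ u X x₀ η δ D L f x g) {t : ℕ} (ht : t ≤ T)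
    (ω : Ω) : ‖twoPointEstimator δ (f t ω) (x t ω) (u t ω)‖ ≤ d * L :=
  norm_twoPointEstimator_le h.delta_pos (h.lipschitz_loss t ht ω) (h.iterate_mem t ω)
    (norm_dir u t ω)

/-- Estimates lag by one index because `u t` is only revealed in `ℱ (t + 1)`; the next iterate,
built from `g t`, is therefore `ℱ (t + 1)`-measurable. Factoring `V` through `W` says that it sees
the losses only through their queried values. -/
theorem measurable_iterate_estimate (h : IsLazyProcess V T μ ℱ u X x₀ η δ D L f x g)
    {W : ℝ × ℝ × EuclideanSpace ℝ (Fin d) × EuclideanSpace ℝ (Fin d) → ℝ≥0∞} (hW : Measurable W)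
    (hV : ∀ f f' y y', V f f' y y' = W (f y, f' y', y, y')) :
    ∀ t ≤ T, Measurable[ℱ t] (x t) ∧ Measurable[ℱ (t + 1)] (g t) := by
  have hdir : ∀ t ≤ T, Measurable[ℱ (t + 1)] fun ω => (u t ω).1 := fun t ht =>
    measurable_subtype_coe.comp (h.measurable_dir t ht)
  have hle : ∀ t, ℱ t ≤ ℱ (t + 1) := fun t => ℱ.mono t.le_succ
  have hcont : ∀ t ≤ T, ∀ ω, ContinuousOn (f t ω) (Metric.cthickening δ X) := fun t ht ω =>
    (h.lipschitz_loss t ht ω).continuousOn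
  have hid : ∀ t, @Measurable Ω Ω (ℱ (t + 1)) (ℱ t) id := fun t s hs => hle t s hs
  have htwo : ∀ t ≤ T, Measurable[ℱ t] (x t) → Measurable[ℱ (t + 1)] fun ω =>
      twoPointEstimator δ (f t ω) (x t ω) (u t ω) := fun t ht hx =>
    measurable_twoPointEstimator h.delta_pos.le (h.measurable_loss t ht) (hcont t ht) (hid t)
      (hx.mono (hle t) le_rfl) (hdir t ht) (h.iterate_mem t) (norm_dir u t)
  have hval : ∀ t ≤ T, Measurable[ℱ t] (x t) → Measurable[ℱ (t + 1)] fun ω =>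
      f t ω (x t ω + δ • (u t ω).1) := by
    intro t ht hx
    have hz : Measurable[ℱ (t + 1)] fun ω => x t ω + δ • (u t ω).1 :=
      (hx.mono (hle t) le_rfl).add ((hdir t ht).const_smul δ)
    exact measurable_eval_of_continuousOn (h.measurable_loss t ht) (hcont t ht) (hid t) hz
      fun ω => add_smul_mem_cthickening h.delta_pos.le (h.iterate_mem t ω) (norm_dir u t ω)
  intro t
  induction t with
  | zero =>
    intro ht
    have hx : Measurable[ℱ 0] (x 0) := by
      rw [show x 0 = fun _ => x₀ from funext h.iterate_zero]
      exact measurable_const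
    refine ⟨hx, ?_⟩
    rw [show g 0 = _ from funext h.estimate_zero]
    exact htwo 0 ht hx
  | succ t ih =>
    intro ht
    have ht' : t ≤ T := by omega
    obtain ⟨hx, hg⟩ := ih ht'
    have hx1 : Measurable[ℱ (t + 1)] (x (t + 1)) := by
      rw [show x (t + 1) = _ from funext (h.iterate_succ t)]
      exact (measurable_euclideanProj h.convex h.closed ⟨x₀, h.mem⟩).comp
        ((hx.mono (hle t) le_rfl).sub (hg.const_smul η))
    refine ⟨hx1, ?_⟩
    rw [show g (t + 1) = _ from funext (h.estimate_succ t)]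
    have hv0 := (hval t ht' hx).mono (hle (t + 1)) le_rfl
    have hv1 := hval (t + 1) ht hx1
    have hu0 := (hdir t ht').mono (hle (t + 1)) le_rfl
    have hu1 := hdir (t + 1) ht
    have hx0' := (hx.mono (hle t) le_rfl).mono (hle (t + 1)) le_rfl
    have hx1' := hx1.mono (hle (t + 1)) le_rfl
    have hWm : Measurable[ℱ (t + 1 + 1)] fun ω => V (f (t + 1) ω) (f t ω)
        (x (t + 1) ω + δ • (u (t + 1) ω).1) (x t ω + δ • (u t ω).1) := by
      simp_rw [hV]
      exact hW.comp (hv1.prodMk (hv0.prodMk ((hx1'.add (hu1.const_smul δ)).prodMk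
        (hx0'.add (hu0.const_smul δ)))))
    unfold lazyEstimator
    refine Measurable.ite (measurableSet_le hWm measurable_const) ?_ (htwo (t + 1) ht hx1)
    unfold residualEstimator
    exact ((hv1.sub hv0).const_mul _).smul hu1

theorem dim_ne_zero [IsProbabilityMeasure μ] (h : IsLazyProcess V T μ ℱ u X x₀ η δ D L f x g) :
    d ≠ 0 := by
  rintro rfl
  obtain ⟨ω⟩ := μ.nonempty_of_neZero
  have := norm_dir u 0 ω
  rw [Subsingleton.elim (u 0 ω).1 0, norm_zero] at this
  exact zero_ne_one this

/-- Conditional second moment of the two-point estimator. -/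
theorem condExp_sq_norm_twoPoint_le [IsProbabilityMeasure μ]
    (h : IsLazyProcess V T μ ℱ u X x₀ η δ D L f x g) {t : ℕ} (ht : t ≤ T)
    (hx : Measurable[ℱ t] (x t)) :
    Integrable (fun ω => ‖twoPointEstimator δ (f t ω) (x t ω) (u t ω)‖ ^ 2) μ ∧
    μ[fun ω => ‖twoPointEstimator δ (f t ω) (x t ω) (u t ω)‖ ^ 2 | ℱ t] ≤ᵐ[μ] fun _ =>
      12 * d * (L : ℝ) ^ 2 := by
  have hcont : ∀ ω, ContinuousOn (f t ω) (Metric.cthickening δ X) := fun ω =>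
    (h.lipschitz_loss t ht ω).continuousOn
  have hu : Measurable (u t) := (h.measurable_dir t ht).mono (ℱ.le _) le_rfl
  -- The past (loss and iterate) sits in the first coordinate, the fresh direction in the second;
  -- the spherical bound applies for each frozen past.
  let φ : Ω × Metric.sphere (0 : EuclideanSpace ℝ (Fin d)) 1 → ℝ := fun p =>
    ‖twoPointEstimator δ (f t p.1) (x t p.1) p.2.1‖ ^ 2
  have hφ : Measurable[(ℱ t).prod inferInstance] φ := by
    refine (measurable_norm.pow_const 2).comp ?_
    refine measurable_twoPointEstimator (Ω := Ω) h.delta_pos.le (h.measurable_loss t ht) hcont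
      (a := Prod.fst) (@measurable_fst _ _ (ℱ t) _)
      (hx.comp (@measurable_fst _ _ (ℱ t) _))
      (measurable_subtype_coe.comp (@measurable_snd _ _ (ℱ t) _)) (fun p => h.iterate_mem t p.1)
      (fun p => by simp)
  have hint : Integrable (fun ω => φ (ω, u t ω)) μ := by
    have hm : Measurable fun ω => φ (ω, u t ω) := by
      refine (measurable_norm.pow_const 2).comp (measurable_twoPointEstimator h.delta_pos.le
        (h.measurable_loss t ht) hcont (a := id) (fun s hs => ℱ.le t s hs)
        (hx.mono (ℱ.le t) le_rfl) (measurable_subtype_coe.comp hu) (h.iterate_mem t)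
        (norm_dir u t))
    refine (integrable_const ((d * L : ℝ) ^ 2)).mono' hm.aestronglyMeasurable
      (.of_forall fun ω => ?_)
    rw [Real.norm_eq_abs, abs_of_nonneg (sq_nonneg _)]
    have := h.norm_twoPoint_le ht ω
    simp only [φ]
    gcongr
  have hC : ∀ ω, ∫ s, φ (ω, s) ∂(μ.map (u t)) ≤ 12 * d * (L : ℝ) ^ 2 := fun ω => by
    rw [h.law_dir t ht]
    have hd : d ≠ 0 := h.dim_ne_zero
    have key := integral_sq_norm_twoPointEstimator_le hd h.delta_pos (h.lipschitz_loss t ht ω)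
      (h.iterate_mem t ω)
    simpa only [φ] using key
  exact ⟨hint, condExp_prod_ae_le_of_indep (ℱ.le t) hu (h.indep_dir t ht) hφ hint hC⟩

theorem integrable_sq_norm_estimate [IsFiniteMeasure μ]
    {t : ℕ} (hg : Measurable[ℱ (t + 1)] (g t)) {M : ℝ} (hM : ∀ ω, ‖g t ω‖ ≤ M) :
    Integrable (fun ω => ‖g t ω‖ ^ 2) μ := by
  have hg' : Measurable (g t) := hg.mono (ℱ.le _) le_rfl
  refine (integrable_const (M ^ 2)).mono' (hg'.norm.pow_const 2).aestronglyMeasurable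
    (.of_forall fun ω => ?_)
  rw [Real.norm_eq_abs, abs_of_nonneg (sq_nonneg _)]
  have := hM ω
  gcongr

/-! ### Variation `a`: a recursion along the run. -/

section TemporalVariationA

theorem measurable_of_temporalVariationA
    (h : IsLazyProcess temporalVariationA T μ ℱ u X x₀ η δ D L f x g) :
    ∀ t ≤ T, Measurable[ℱ t] (x t) ∧ Measurable[ℱ (t + 1)] (g t) :=
  h.measurable_iterate_estimate
    (W := fun q => ENNReal.ofReal |q.1 - q.2.1| / ENNReal.ofReal ‖q.2.2.1 - q.2.2.2‖)
    (by
      refine Measurable.div (ENNReal.measurable_ofReal.comp ?_) (by fun_prop)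
      exact (continuous_abs.measurable).comp (by fun_prop)) fun _ _ _ _ => rfl

theorem norm_estimate_le_or_eq_of_temporalVariationA
    (h : IsLazyProcess temporalVariationA T μ ℱ u X x₀ η δ D L f x g) (t : ℕ) (ω : Ω) :
    ‖g (t + 1) ω‖ ≤ d / δ * (D * (η * ‖g t ω‖ + 2 * δ)) ∨
      g (t + 1) ω = twoPointEstimator δ (f (t + 1) ω) (x (t + 1) ω) (u (t + 1) ω) := by
  have hδ := h.delta_pos
  have hD := h.threshold_pos
  rw [h.estimate_succ t ω]
  refine (norm_lazyEstimator_temporalVariationA hδ hD.le (norm_dir u (t + 1) ω)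
    (norm_dir u t ω)).imp_left fun h1 => h1.trans ?_
  have := h.norm_iterate_sub_le t ω
  gcongr

theorem sq_norm_estimate_le_or_eq_of_temporalVariationA
    (h : IsLazyProcess temporalVariationA T μ ℱ u X x₀ η δ D L f x g) (t : ℕ) (ω : Ω) :
    ‖g (t + 1) ω‖ ^ 2 ≤ 2 * (d : ℝ) ^ 2 * D ^ 2 * η ^ 2 / δ ^ 2 * ‖g t ω‖ ^ 2
        + 8 * (d : ℝ) ^ 2 * D ^ 2 ∨
      g (t + 1) ω = twoPointEstimator δ (f (t + 1) ω) (x (t + 1) ω) (u (t + 1) ω) := by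
  have hδ := h.delta_pos
  refine (h.norm_estimate_le_or_eq_of_temporalVariationA t ω).imp_left fun h1 => ?_
  calc ‖g (t + 1) ω‖ ^ 2 ≤ (d / δ * (D * (η * ‖g t ω‖ + 2 * δ))) ^ 2 := by gcongr
    _ = (d / δ * D) ^ 2 * (η * ‖g t ω‖ + 2 * δ) ^ 2 := by ring
    -- Source of the constants `2` and `8 = 2 * 2 ^ 2`.
    _ ≤ (d / δ * D) ^ 2 * (2 * ((η * ‖g t ω‖) ^ 2 + (2 * δ) ^ 2)) := by
      gcongr
      exact add_sq_le
    _ = _ := by field_simp; ring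

/-- Only for integrability: iterating the dichotomy gives a deterministic bound at each time, with
no control on its growth. -/
theorem exists_norm_estimate_le_of_temporalVariationA
    (h : IsLazyProcess temporalVariationA T μ ℱ u X x₀ η δ D L f x g) :
    ∀ t ≤ T, ∃ M, ∀ ω, ‖g t ω‖ ≤ M := by
  have hδ := h.delta_pos
  have hD := h.threshold_pos
  have hη := h.eta_pos
  intro t
  induction t with
  | zero =>
    intro ht
    refine ⟨d * L, fun ω => ?_⟩
    rw [h.estimate_zero]
    exact h.norm_twoPoint_le ht ω
  | succ t ih =>
    intro ht
    obtain ⟨M, hM⟩ := ih (by omega)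
    refine ⟨max (d / δ * (D * (η * M + 2 * δ))) (d * L), fun ω => ?_⟩
    rcases h.norm_estimate_le_or_eq_of_temporalVariationA t ω with h1 | h1
    · refine (h1.trans ?_).trans (le_max_left _ _)
      have := hM ω
      gcongr
    · rw [h1]
      exact (h.norm_twoPoint_le ht ω).trans (le_max_right _ _)

theorem integrable_of_temporalVariationA [IsFiniteMeasure μ]
    (h : IsLazyProcess temporalVariationA T μ ℱ u X x₀ η δ D L f x g) {t : ℕ} (ht : t ≤ T) :
    Integrable (fun ω => ‖g t ω‖ ^ 2) μ := by
  obtain ⟨M, hM⟩ := h.exists_norm_estimate_le_of_temporalVariationA t ht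
  exact integrable_sq_norm_estimate (h.measurable_of_temporalVariationA t ht).2 hM

theorem condExp_le_of_temporalVariationA [IsProbabilityMeasure μ]
    (h : IsLazyProcess temporalVariationA T μ ℱ u X x₀ η δ D L f x g) {t : ℕ} (ht : t + 1 ≤ T) :
    μ[fun ω => ‖g (t + 1) ω‖ ^ 2 | ℱ (t + 1)] ≤ᵐ[μ] fun ω =>
      12 * d * (L : ℝ) ^ 2 + 2 * (d : ℝ) ^ 2 * D ^ 2 * η ^ 2 / δ ^ 2 * ‖g t ω‖ ^ 2
        + 8 * (d : ℝ) ^ 2 * D ^ 2 := by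
  have ht' : t ≤ T := by omega
  have hg := (h.measurable_of_temporalVariationA t ht').2
  obtain ⟨hZ, hC⟩ := h.condExp_sq_norm_twoPoint_le ht (h.measurable_of_temporalVariationA _ ht).1
  have hA : Integrable (fun ω => 2 * (d : ℝ) ^ 2 * D ^ 2 * η ^ 2 / δ ^ 2 * ‖g t ω‖ ^ 2
        + 8 * (d : ℝ) ^ 2 * D ^ 2) μ :=
    ((h.integrable_of_temporalVariationA ht').const_mul _).add (integrable_const _)
  have hAm : Measurable[ℱ (t + 1)] (fun ω => 2 * (d : ℝ) ^ 2 * D ^ 2 * η ^ 2 / δ ^ 2 *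
      ‖g t ω‖ ^ 2 + 8 * (d : ℝ) ^ 2 * D ^ 2) :=
    (((measurable_norm.pow_const 2).comp hg).const_mul _).add_const _
  have key := condExp_ae_le_add_of_le_add (ℱ.le (t + 1)) (h.integrable_of_temporalVariationA ht)
    hA hAm.stronglyMeasurable hZ (fun ω => ?_) hC
  · filter_upwards [key] with ω hω
    linarith
  · rcases h.sq_norm_estimate_le_or_eq_of_temporalVariationA t ω with h1 | h1
    · exact h1.trans (le_add_of_nonneg_right (sq_nonneg _))
    · rw [h1]
      exact le_add_of_nonneg_left (by positivity)

/-- Below the critical threshold the bound `d * L` on the estimates is preserved along the run. -/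
theorem norm_estimate_le_of_temporalVariationA
    (h : IsLazyProcess temporalVariationA T μ ℱ u X x₀ η δ D L f x g)
    (hηδ : η / δ * (d * L) = 1) (hDL : 10 * D ^ 2 ≤ (L : ℝ) ^ 2) :
    ∀ t ≤ T, ∀ ω, ‖g t ω‖ ^ 2 ≤ (d * L : ℝ) ^ 2 := by
  have htwo : ∀ t ≤ T, ∀ ω,
      ‖twoPointEstimator δ (f t ω) (x t ω) (u t ω)‖ ^ 2 ≤ (d * L : ℝ) ^ 2 := fun t ht ω => by
    have := h.norm_twoPoint_le ht ω
    gcongr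
  intro t
  induction t with
  | zero =>
    intro ht ω
    rw [h.estimate_zero]
    exact htwo 0 ht ω
  | succ t ih =>
    intro ht ω
    rcases h.sq_norm_estimate_le_or_eq_of_temporalVariationA t ω with h1 | h1
    · have h2 := ih (by omega) ω
      calc _ ≤ _ := h1
        _ ≤ 2 * (d : ℝ) ^ 2 * D ^ 2 * η ^ 2 / δ ^ 2 * (d * L) ^ 2 + 8 * (d : ℝ) ^ 2 * D ^ 2 := by
          gcongr
        _ = 2 * (d : ℝ) ^ 2 * D ^ 2 * (η / δ * (d * L)) ^ 2 + 8 * (d : ℝ) ^ 2 * D ^ 2 := by ring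
        -- The critical `10` is `2 + 8`: the feedback coefficient becomes `2` under `hηδ`.
        _ = (d : ℝ) ^ 2 * (10 * D ^ 2) := by rw [hηδ]; ring
        _ ≤ (d : ℝ) ^ 2 * (L : ℝ) ^ 2 := by gcongr
        _ = _ := by ring
    · rw [h1]
      exact htwo _ ht ω

theorem condExp_le_const_of_temporalVariationA [IsProbabilityMeasure μ]
    (h : IsLazyProcess temporalVariationA T μ ℱ u X x₀ η δ D L f x g)
    (hηδ : η / δ * (d * L) = 1) (hDL : 10 * D ^ 2 ≤ (L : ℝ) ^ 2) {t : ℕ} (ht : t ≤ T) :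
    μ[fun ω => ‖g t ω‖ ^ 2 | ℱ t] ≤ᵐ[μ] fun _ =>
      12 * d * (L : ℝ) ^ 2 + 10 * (d : ℝ) ^ 2 * D ^ 2 := by
  cases t with
  | zero =>
    have h1 := (h.condExp_sq_norm_twoPoint_le ht (h.measurable_of_temporalVariationA _ ht).1).2
    simp_rw [h.estimate_zero]
    filter_upwards [h1] with ω hω
    exact hω.trans (le_add_of_nonneg_right (by positivity))
  | succ t =>
    filter_upwards [h.condExp_le_of_temporalVariationA ht] with ω hω
    refine hω.trans ?_
    have h2 := h.norm_estimate_le_of_temporalVariationA hηδ hDL t (by omega) ω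
    calc _ ≤ 12 * d * (L : ℝ) ^ 2 + 2 * (d : ℝ) ^ 2 * D ^ 2 * η ^ 2 / δ ^ 2 * (d * L) ^ 2
          + 8 * (d : ℝ) ^ 2 * D ^ 2 := by gcongr
      _ = 12 * d * (L : ℝ) ^ 2 + 2 * (d : ℝ) ^ 2 * D ^ 2 * (η / δ * (d * L)) ^ 2
          + 8 * (d : ℝ) ^ 2 * D ^ 2 := by ring
      _ = _ := by rw [hηδ]; ring

end TemporalVariationA

/-! ### Variation `b`: no feedback from the previous estimate. -/

section TemporalVariationB

theorem measurable_of_temporalVariationB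
    (h : IsLazyProcess (temporalVariationB η L) T μ ℱ u X x₀ η δ D L f x g) :
    ∀ t ≤ T, Measurable[ℱ t] (x t) ∧ Measurable[ℱ (t + 1)] (g t) :=
  h.measurable_iterate_estimate
    (W := fun q => ENNReal.ofReal |q.1 - q.2.1| / ENNReal.ofReal (η * L))
    (by
      refine Measurable.div (ENNReal.measurable_ofReal.comp ?_) (by fun_prop)
      exact (continuous_abs.measurable).comp (by fun_prop)) fun _ _ _ _ => rfl

theorem norm_estimate_le_or_eq_of_temporalVariationB
    (h : IsLazyProcess (temporalVariationB η L) T μ ℱ u X x₀ η δ D L f x g) (t : ℕ) (ω : Ω) :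
    ‖g t ω‖ ≤ d / δ * (D * (η * L)) ∨
      g t ω = twoPointEstimator δ (f t ω) (x t ω) (u t ω) := by
  cases t with
  | zero => exact .inr (h.estimate_zero ω)
  | succ t =>
    rw [h.estimate_succ t ω]
    exact norm_lazyEstimator_temporalVariationB h.delta_pos h.threshold_pos.le h.eta_pos.le
      (norm_dir u (t + 1) ω)

theorem integrable_of_temporalVariationB [IsFiniteMeasure μ]
    (h : IsLazyProcess (temporalVariationB η L) T μ ℱ u X x₀ η δ D L f x g) {t : ℕ} (ht : t ≤ T) :
    Integrable (fun ω => ‖g t ω‖ ^ 2) μ := by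
  refine integrable_sq_norm_estimate (h.measurable_of_temporalVariationB t ht).2
    (M := max (d / δ * (D * (η * L))) (d * L)) fun ω => ?_
  rcases h.norm_estimate_le_or_eq_of_temporalVariationB t ω with h1 | h1
  · exact h1.trans (le_max_left _ _)
  · rw [h1]
    exact (h.norm_twoPoint_le ht ω).trans (le_max_right _ _)

theorem condExp_le_of_temporalVariationB [IsProbabilityMeasure μ]
    (h : IsLazyProcess (temporalVariationB η L) T μ ℱ u X x₀ η δ D L f x g) {t : ℕ} (ht : t ≤ T) :
    μ[fun ω => ‖g t ω‖ ^ 2 | ℱ t] ≤ᵐ[μ] fun _ =>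
      D ^ 2 * η ^ 2 * (d : ℝ) ^ 2 * (L : ℝ) ^ 2 / δ ^ 2 + 12 * d * (L : ℝ) ^ 2 := by
  obtain ⟨hZ, hC⟩ := h.condExp_sq_norm_twoPoint_le ht (h.measurable_of_temporalVariationB _ ht).1
  refine condExp_ae_le_add_of_le_add (ℱ.le t) (h.integrable_of_temporalVariationB ht)
    (integrable_const _) stronglyMeasurable_const hZ (fun ω => ?_) hC
  rcases h.norm_estimate_le_or_eq_of_temporalVariationB t ω with h1 | h1
  · refine le_add_of_le_of_nonneg ?_ (sq_nonneg _)
    calc ‖g t ω‖ ^ 2 ≤ (d / δ * (D * (η * L))) ^ 2 := by gcongr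
      _ = _ := by ring
  · rw [h1]
    exact le_add_of_nonneg_left (by positivity)

end TemporalVariationB

end IsLazyProcess

/-! ### Tuned parameters and the final assembly. -/

/-- The recommended step size and smoothing radius satisfy `η / δ = 1 / (d * L)`. -/
theorem stepSize_div_radius_mul {R L d T η δ : ℝ} (hd : 0 ≤ d) (hη : 0 < η) (hδ : 0 < δ)
    (hη' : η = R / (L * √(d * T))) (hδ' : δ = R * √(d / T)) : η / δ * (d * L) = 1 := by
  -- Degenerate parameters would make `η` or `δ` equal to `0`, under `x / 0 = 0` and `√` of a
  -- nonpositive number being `0`; positivity of both excludes them.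
  have hR : R ≠ 0 := by rintro rfl; simp at hη'; exact hη.ne' hη'
  have hL : L ≠ 0 := by rintro rfl; simp at hη'; exact hη.ne' hη'
  have hs : √(d / T) ≠ 0 := by intro h0; rw [h0, mul_zero] at hδ'; exact hδ.ne' hδ'
  have hd0 : d ≠ 0 := by rintro rfl; simp at hs
  have hq : 0 < d / T := Real.sqrt_ne_zero'.1 hs
  have hT : 0 < T := by
    by_contra hT
    exact absurd hq (not_lt.2 (div_nonpos_of_nonneg_of_nonpos hd (not_lt.1 hT)))
  have hprod : √(d * T) * √(d / T) = d := by
    rw [← Real.sqrt_mul (by positivity), show d * T * (d / T) = d ^ 2 by field_simp,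
      Real.sqrt_sq hd]
  have hs1 : √(d * T) ≠ 0 := by intro h0; rw [h0, zero_mul] at hprod; exact hd0 hprod.symm
  rw [hη', hδ']
  calc R / (L * √(d * T)) / (R * √(d / T)) * (d * L) = d / (√(d * T) * √(d / T)) := by
        field_simp
    _ = 1 := by rw [hprod, div_self hd0]

theorem lemma4 :
    ∃ c : ℝ, 0 < c ∧
      ∀ (d T : ℕ)
        -- the probability space and the information `ℱ t` available before `u t` is drawn
        (Ω : Type*) (mΩ : MeasurableSpace Ω) (μ : Measure Ω) (_ : IsProbabilityMeasure μ)
        (ℱ : Filtration ℕ mΩ)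
        -- the random directions, uniform on the sphere and independent of the past
        (u : ℕ → Ω → Metric.sphere (0 : EuclideanSpace ℝ (Fin d)) 1)
        (_ : ∀ t ≤ T, Measurable[ℱ (t + 1)] (u t))
        (_ : ∀ t ≤ T, μ.map (u t) = uniformSphere d)
        (_ : ∀ t ≤ T, Indep (MeasurableSpace.comap (u t) inferInstance) (ℱ t) μ)
        -- the bounded feasible set, the starting point and the parameters
        (X : Set (EuclideanSpace ℝ (Fin d))) (_ : Convex ℝ X) (_ : IsClosed X)
        (R : ℝ) (_ : X ⊆ Metric.closedBall 0 R)
        (x₀ : EuclideanSpace ℝ (Fin d)) (_ : x₀ ∈ X)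
        (η δ D : ℝ) (_ : 0 < η) (_ : 0 < δ) (_ : 0 < D)
        -- the losses, chosen by nature from the past, convex and Lipschitz
        (f : ℕ → Ω → EuclideanSpace ℝ (Fin d) → ℝ)
        (_ : ∀ t ≤ T, ∀ x ∈ Metric.cthickening δ X, Measurable[ℱ t] (fun ω => f t ω x))
        (_ : ∀ t ≤ T, ∀ ω, ConvexOn ℝ X (f t ω))
        (Lt : ℕ → ℝ≥0)
        (_ : ∀ t ≤ T, ∀ ω, LipschitzOnWith (Lt t) (f t ω) (Metric.cthickening δ X))
        (L : ℝ≥0) (_ : L = (Finset.range (T + 1)).sup Lt)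
        -- the iterates and the gradient estimates of the two methods
        (xa ga xb gb : ℕ → Ω → EuclideanSpace ℝ (Fin d))
        (_ : ∀ t ω, (xa t ω, ga t ω) =
          lazoRun temporalVariationA X x₀ η δ D (fun s => f s ω) (fun s => (u s ω).1) t)
        (_ : ∀ t ω, (xb t ω, gb t ω) =
          lazoRun (temporalVariationB η L) X x₀ η δ D (fun s => f s ω) (fun s => (u s ω).1) t),
        -- the conditional expectations below are those of integrable functions, and the
        -- iterates are determined by the past
        (∀ t ≤ T, Measurable[ℱ t] (xa t) ∧ Integrable (fun ω => ‖ga t ω‖ ^ 2) μ ∧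
          Measurable[ℱ t] (xb t) ∧ Integrable (fun ω => ‖gb t ω‖ ^ 2) μ) ∧
        -- first method, given the past
        (∀ t, t + 1 ≤ T →
          μ[fun ω => ‖ga (t + 1) ω‖ ^ 2 | ℱ (t + 1)] ≤ᵐ[μ] fun ω =>
            c * d * (L : ℝ) ^ 2 + 2 * (d : ℝ) ^ 2 * D ^ 2 * η ^ 2 / δ ^ 2 * ‖ga t ω‖ ^ 2
              + 8 * (d : ℝ) ^ 2 * D ^ 2) ∧
        -- first method, given only the iterate
        (∀ t, t + 1 ≤ T →
          μ[fun ω => ‖ga (t + 1) ω‖ ^ 2 | MeasurableSpace.comap (xa (t + 1)) inferInstance]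
            ≤ᵐ[μ] fun ω =>
            c * d * (L : ℝ) ^ 2 + 2 * (d : ℝ) ^ 2 * D ^ 2 * η ^ 2 / δ ^ 2 *
                (μ[fun ω' => ‖ga t ω'‖ ^ 2 |
                  MeasurableSpace.comap (xa (t + 1)) inferInstance]) ω
              + 8 * (d : ℝ) ^ 2 * D ^ 2) ∧
        -- second method, given the past and given only the iterate
        (∀ t ≤ T,
          μ[fun ω => ‖gb t ω‖ ^ 2 | ℱ t] ≤ᵐ[μ] fun _ =>
            D ^ 2 * η ^ 2 * (d : ℝ) ^ 2 * (L : ℝ) ^ 2 / δ ^ 2 + c * d * (L : ℝ) ^ 2) ∧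
        (∀ t ≤ T,
          μ[fun ω => ‖gb t ω‖ ^ 2 | MeasurableSpace.comap (xb t) inferInstance] ≤ᵐ[μ] fun _ =>
            D ^ 2 * η ^ 2 * (d : ℝ) ^ 2 * (L : ℝ) ^ 2 / δ ^ 2 + c * d * (L : ℝ) ^ 2) ∧
        -- both bounds are of order `d` for the chosen step size, smoothing radius and threshold
        (η = R / (L * √(d * T)) → δ = R * √(d / T) →
          (∀ K : ℝ, D ≤ K * (L / √d) → D < L / √10 → ∀ t ≤ T,
            μ[fun ω => ‖ga t ω‖ ^ 2 | ℱ t] ≤ᵐ[μ] fun _ =>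
              (c + 10 * K ^ 2) * d * (L : ℝ) ^ 2) ∧
          (∀ K : ℝ, D ≤ K * (√d * L) → ∀ t ≤ T,
            μ[fun ω => ‖gb t ω‖ ^ 2 | ℱ t] ≤ᵐ[μ] fun _ =>
              (c + K ^ 2) * d * (L : ℝ) ^ 2)) := by

  refine ⟨12, by norm_num, ?_⟩
  intro d T Ω mΩ μ _ ℱ u hu hlaw hind X hcv hcl R _ x₀ hx₀ η δ D hη hδ hD f hfm _ Lt hLip L hL
    xa ga xb gb hA hB
  have hLip' : ∀ t ≤ T, ∀ ω, LipschitzOnWith L (f t ω) (Metric.cthickening δ X) := fun t ht ω =>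
    (hLip t ht ω).weaken (hL ▸ Finset.le_sup (Finset.mem_range.2 (by omega)))
  have pa : IsLazyProcess temporalVariationA T μ ℱ u X x₀ η δ D L f xa ga :=
    ⟨hu, hlaw, hind, hcv, hcl, hx₀, hη, hδ, hD, hfm, hLip', hA⟩
  have pb : IsLazyProcess (temporalVariationB η L) T μ ℱ u X x₀ η δ D L f xb gb :=
    ⟨hu, hlaw, hind, hcv, hcl, hx₀, hη, hδ, hD, hfm, hLip', hB⟩
  have hd : (0 : ℝ) < d := Nat.cast_pos.2 (Nat.pos_of_ne_zero pa.dim_ne_zero)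
  refine ⟨fun t ht => ⟨(pa.measurable_of_temporalVariationA t ht).1,
      pa.integrable_of_temporalVariationA ht, (pb.measurable_of_temporalVariationB t ht).1,
      pb.integrable_of_temporalVariationB ht⟩,
    fun t ht => pa.condExp_le_of_temporalVariationA ht, fun t ht => ?_,
    fun t ht => pb.condExp_le_of_temporalVariationB ht, fun t ht => ?_,
    fun hη' hδ' => ?_⟩
  -- Tower property: the iterate is determined by the past, so its σ-algebra is contained in `ℱ (t +
  -- 1)`.
  · exact condExp_ae_le_affine_of_le (pa.measurable_of_temporalVariationA _ ht).1.comap_le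
      (ℱ.le _) (pa.integrable_of_temporalVariationA (by omega))
      (pa.condExp_le_of_temporalVariationA ht)
  · exact condExp_ae_le_const_of_le (pb.measurable_of_temporalVariationB _ ht).1.comap_le (ℱ.le _)
      (pb.condExp_le_of_temporalVariationB ht)
  have hηδ : η / δ * (d * L) = 1 := stepSize_div_radius_mul hd.le hη hδ hη' hδ'
  have hsd : √(d : ℝ) ^ 2 = d := Real.sq_sqrt hd.le
  have hsd0 : 0 < √(d : ℝ) := Real.sqrt_pos.2 hd
  refine ⟨fun K hK hDL t ht => ?_, fun K hK t ht => ?_⟩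
  · have h10 : 10 * D ^ 2 ≤ (L : ℝ) ^ 2 := by
      have h1 : D ^ 2 ≤ (L / √10 : ℝ) ^ 2 := by gcongr
      rw [div_pow, Real.sq_sqrt (by norm_num)] at h1
      linarith
    have hKD : (d : ℝ) * D ^ 2 ≤ K ^ 2 * (L : ℝ) ^ 2 := by
      have h1 : D ^ 2 ≤ (K * (L / √d)) ^ 2 := by gcongr
      rw [mul_pow, div_pow, hsd] at h1
      calc (d : ℝ) * D ^ 2 ≤ d * (K ^ 2 * ((L : ℝ) ^ 2 / d)) := by gcongr
        _ = _ := by field_simp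
    filter_upwards [pa.condExp_le_const_of_temporalVariationA hηδ h10 ht] with ω hω
    refine hω.trans ?_
    nlinarith [mul_le_mul_of_nonneg_left hKD hd.le]
  · have hKD : D ^ 2 ≤ K ^ 2 * (d * (L : ℝ) ^ 2) := by
      have h1 : D ^ 2 ≤ (K * (√d * L)) ^ 2 := by gcongr
      rwa [mul_pow, mul_pow, hsd] at h1
    filter_upwards [pb.condExp_le_of_temporalVariationB ht] with ω hω
    refine hω.trans ?_
    calc D ^ 2 * η ^ 2 * (d : ℝ) ^ 2 * (L : ℝ) ^ 2 / δ ^ 2 + 12 * d * (L : ℝ) ^ 2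
        = D ^ 2 * (η / δ * (d * L)) ^ 2 + 12 * d * (L : ℝ) ^ 2 := by ring
      _ = D ^ 2 + 12 * d * (L : ℝ) ^ 2 := by rw [hηδ]; ring
      _ ≤ _ := by linarith
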